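/- Let $(\Omega,\mathcal E,\mathbb P)$ be a probability space and $\mathcal F\subset\mathcal E$ a sub-$\sigma$-algebra; random variables that agree almost surely are identified, and (in)equalities between them hold almost surely. $L^0(\mathcal F)$ is the space of real $\mathcal F$-measurable random variables and $L^0_{++}(\mathcal F)$ the set of its almost surely strictly positive elements. A Young function is an increasing, left-continuous, convex function $\varphi:[0,\infty)\to[0,\infty]$, finite on a neighbourhood of $0$, with $\varphi(0)=0$ and $\lim_{t\to\infty}\varphi(t)=\infty$; its conjugate is $\varphi^*(s)=\sup_{t\ge 0}(ts-\varphi(t))$. For a $\sigma$-algebra $\mathcal G\subset\mathcal E$ let $L^\varphi(\mathcal G)$ be the set of $\mathcal G$-measurable $x$ with $\mathbb E[\varphi(|x|/c)]<\infty$ for some real $c>0$, and let $$L^\varphi_{\mathcal F}(\mathcal E)=\{x\in L^0(\mathcal E)\;:\;\mathbb E[\varphi(|x|\lambda^{-1})\,|\,\mathcal F]<\infty \text{ a.s. for some } \lambda\in L^0_{++}(\mathcal F)\}.$$ Every $x\in L^\varphi_{\mathcal F}(\mathcal E)$ has the form $x=\sum_k 1_{A_k}x_k$ with $\{A_k\}_{k\in\mathbb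 N}$ a countable $\mathcal F$-measurable partition of $\Omega$ and $x_k\in L^\varphi(\mathcal E)$. The conditional expectation is extended from $L^1(\mathcal E)$ to sums $x=\sum_k1_{A_k}x_k$ of this kind with $x_k\in L^1(\mathcal E)$ by $\mathbb E[x|\mathcal F]=\sum_k1_{A_k}\mathbb E[x_k|\mathcal F]$. Let $\varphi,\psi$ be Young functions with $\psi\le\varphi$ and let $\rho:L^\varphi(\mathcal E)\to L^\psi(\mathcal F)$ be a conditional convex risk measure, that is, for all $x,y\in L^\varphi(\mathcal E)$: $x\le y$ implies $\rho(x)\ge\rho(y)$; $\rho(\lambda x+(1-\lambda)y)\le\lambda\rho(x)+(1-\lambda)\rho(y)$ for all $\lambda\in L^0(\mathcal F)$ with $0\le\lambda\le1$; and $\rho(x+\lambda)=\rho(x)-\lambda$ for all $\lambda\in L^\varphi(\mathcal F)$. Let $\bar\rho:L^\varphi_{\mathcal F}(\mathcal E)\to L^0(\mathcal F)$ be its stable extension, $\bar\rho(\sum_k1_{A_k}x_k)=\sum_k1_{A_k}\rho(x_k)$ for $x_k\in L^\varphi(\mathcal E)$ and $\mathcal F$-measurable partitions $\{A_k\}$.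 Put $$\rho^*(y)=\operatorname{ess\,sup}\{\mathbb E[xy|\mathcal F]-\rho(x): x\in L^\varphi(\mathcal E)\}\ \text{ for } y\in L^{\varphi^*}(\mathcal E),$$ $$\bar\rho^*(y)=\operatorname{ess\,sup}\{\mathbb E[xy|\mathcal F]-\bar\rho(x): x\in L^\varphi_{\mathcal F}(\mathcal E)\}\ \text{ for } y\in L^{\varphi^*}_{\mathcal F}(\mathcal E).$$ Let $\sigma(L^\varphi_{\mathcal F}(\mathcal E),L^{\varphi^*}_{\mathcal F}(\mathcal E))$ be the topology on $L^\varphi_{\mathcal F}(\mathcal E)$ in which the sets $\{z: |\mathbb E[(z-x)q|\mathcal F]|\le\varepsilon\ \text{for all } q\in Q\}$, with $Q\subset L^{\varphi^*}_{\mathcal F}(\mathcal E)$ finite and $\varepsilon\in L^0_{++}(\mathcal F)$, form a neighbourhood base at each $x$; $\bar\rho$ is called lower semicontinuous for it if $\{x:\bar\rho(x)\le c\}$ is closed for every $c\in L^0(\mathcal F)$. Then the following are equivalent: 1. $\bar\rho$ is $\sigma(L^\varphi_{\mathcal F}(\mathcal E),L^{\varphi^*}_{\mathcal F}(\mathcal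 E))$-lower semicontinuous; 2. for every $x\in L^\varphi_{\mathcal F}(\mathcal E)$, $$\bar\rho(x)=\operatorname{ess\,sup}\{\mathbb E[xy|\mathcal F]-\bar\rho^*(y)\;:\;y\in L^{\varphi^*}_{\mathcal F}(\mathcal E),\ \mathbb E[y|\mathcal F]=-1,\ y\le0\};$$ 3. for every $x\in L^\varphi(\mathcal E)$, $$\rho(x)=\operatorname{ess\,sup}\{\mathbb E[xy|\mathcal F]-\rho^*(y)\;:\;y\in L^{\varphi^*}(\mathcal E),\ \mathbb E[y|\mathcal F]=-1,\ y\le0\}.$$ -/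

import Mathlib

open MeasureTheory Set Filter Topology
open scoped NNReal ENNReal

noncomputable section

namespace CondRisk

/-- Young functions `[0,∞) → [0,∞]`: increasing, left-continuous, convex, finite on a neighbourhood
of `0`, vanishing at `0`, and tending to `∞` at `∞`. -/
structure IsYoung (φ : ℝ≥0 → ℝ≥0∞) : Prop where
  mono : Monotone φ
  leftCont : ∀ t, ContinuousWithinAt φ (Iic t) t
  convex : ConvexOn ℝ≥0 univ φ
  finite_near_zero : ∀ᶠ t in 𝓝 (0 : ℝ≥0), φ t < ∞
  map_zero : φ 0 = 0
  tendsto_top : Tendsto φ atTop (𝓝 ∞)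

/-- The conjugate `φ*(s) = sup_{t ≥ 0} (t s - φ(t))`. The truncated subtraction of `[0,∞]` does not
change the supremum, since `t = 0` contributes `-φ(0) = 0`. -/
def conj (φ : ℝ≥0 → ℝ≥0∞) (s : ℝ≥0) : ℝ≥0∞ := ⨆ t : ℝ≥0, ((t : ℝ≥0∞) * s - φ t)

section Spaces

variable {Ω : Type*} (m : MeasurableSpace Ω) {m0 : MeasurableSpace Ω} (μ : Measure[m0] Ω)

/-- `L⁰(𝓕)`, as the set of those classes in `L⁰(𝓔)` which have an `m`-measurable representative. -/
def L0 : Set (Ω →ₘ[μ] ℝ) := {x | AEStronglyMeasurable[m] x μ}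

/-- `L⁰₊₊(𝓕)`: the elements of `L⁰(𝓕)` that are strictly positive almost surely. -/
def L0pp : Set (Ω →ₘ[μ] ℝ) := {x | x ∈ L0 m μ ∧ ∀ᵐ ω ∂μ, 0 < x ω}

/-- The Orlicz space over the σ-algebra `m`: the `m`-measurable `x` with
`E[φ(|x| / c)] < ∞` for some real `c > 0`. -/
def orlicz (φ : ℝ≥0 → ℝ≥0∞) : Set (Ω →ₘ[μ] ℝ) :=
  {x | x ∈ L0 m μ ∧ ∃ c : ℝ≥0, 0 < c ∧ ∫⁻ ω, φ (‖x ω‖₊ / c) ∂μ < ∞}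

/-- The Orlicz-type module `L^φ_𝓕(𝓔)`: the `x ∈ L⁰(𝓔)` with
`E[φ(|x| / l) | 𝓕] < ∞` almost surely for some `l ∈ L⁰₊₊(𝓕)`. -/
def orliczModule (φ : ℝ≥0 → ℝ≥0∞) : Set (Ω →ₘ[μ] ℝ) :=
  {x | ∃ l ∈ L0pp m μ, ∀ᵐ ω ∂μ, condLExp m μ (fun ω => φ (‖x ω‖₊ / ‖l ω‖₊)) ω < ∞}

/-- Countable partitions of `Ω` into `m`-measurable sets (possibly empty). -/
def IsPartition (A : ℕ → Set Ω) : Prop :=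
  (∀ k, MeasurableSet[m] (A k)) ∧ Pairwise (fun i j => Disjoint (A i) (A j)) ∧ ⋃ k, A k = univ

variable {μ} in
/-- `x = ∑ₖ 1_{A k} xs k`. -/
def IsConcat (A : ℕ → Set Ω) (xs : ℕ → (Ω →ₘ[μ] ℝ)) (x : Ω →ₘ[μ] ℝ) : Prop :=
  ∀ k, ∀ᵐ ω ∂μ, ω ∈ A k → x ω = xs k ω

variable {μ} in
/-- The stable extension of `f : D → L⁰` to the countable concatenation hull of `D`:
`f̄(∑ₖ 1_{A k} xₖ) = ∑ₖ 1_{A k} f(xₖ)` for `xₖ ∈ D`. (For the `f` considered below the right-hand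
side does not depend on the chosen way of writing the argument.) -/
def stableExt (D : Set (Ω →ₘ[μ] ℝ)) (f : (Ω →ₘ[μ] ℝ) → (Ω →ₘ[μ] ℝ)) (x : Ω →ₘ[μ] ℝ) :
    Ω →ₘ[μ] ℝ :=
  Classical.epsilon fun z => ∃ (A : ℕ → Set Ω) (xs : ℕ → (Ω →ₘ[μ] ℝ)),
    IsPartition m A ∧ (∀ k, xs k ∈ D) ∧ IsConcat A xs x ∧ IsConcat A (fun k => f (xs k)) z

/-- The classical conditional expectation `L¹(𝓔) → L¹(𝓕)` as a map between classes. -/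
def condE (x : Ω →ₘ[μ] ℝ) : Ω →ₘ[μ] ℝ :=
  AEEqFun.mk (condExp m μ x) integrable_condExp.aestronglyMeasurable

/-- The conditional expectation extended from `L¹(𝓔)` to `L¹_𝓕(𝓔)`, its concatenation hull. -/
def condEExt (x : Ω →ₘ[μ] ℝ) : Ω →ₘ[μ] ℝ :=
  stableExt m {z : Ω →ₘ[μ] ℝ | Integrable z μ} (condE m μ) x

end Spaces

section EssSup

variable {Ω : Type*} {m0 : MeasurableSpace Ω} {μ : Measure[m0] Ω}

/-- The inclusion of `L⁰` into the classes of extended real valued random variables. -/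
def toE (x : Ω →ₘ[μ] ℝ) : Ω →ₘ[μ] EReal := AEEqFun.comp Real.toEReal continuous_coe_real_ereal x

theorem measurable_ereal_sub :
    Measurable (Function.uncurry (fun a b : EReal => a - b)) := by
  have : Function.uncurry (fun a b : EReal => a - b) = fun p => p.1 + -p.2 := by
    ext p; simp [Function.uncurry, sub_eq_add_neg]
  rw [this]
  exact measurable_fst.add ((continuous_neg (G := EReal)).measurable.comp measurable_snd)

/-- `x - g` for `x ∈ L⁰` and an extended real valued `g`. -/
def subE (x : Ω →ₘ[μ] ℝ) (g : Ω →ₘ[μ] EReal) : Ω →ₘ[μ] EReal :=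
  AEEqFun.comp₂Measurable (fun a b : EReal => a - b) measurable_ereal_sub (toE x) g

/-- The essential supremum of a family of (classes of) extended real valued random variables: its
least upper bound for the almost sure order, which exists by `isLUB_esssup`. -/
def esssup (C : Set (Ω →ₘ[μ] EReal)) : Ω →ₘ[μ] EReal := Classical.epsilon fun g => IsLUB C g

theorem exists_isLUB [IsFiniteMeasure μ] (C : Set (Ω →ₘ[μ] EReal)) : ∃ g, IsLUB C g := by
  rcases C.eq_empty_or_nonempty with rfl | hC
  · refine ⟨AEEqFun.const Ω ⊥, by simp, fun b _ => ?_⟩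
    rw [← AEEqFun.coeFn_le]
    filter_upwards [AEEqFun.coeFn_const (μ := μ) Ω (⊥ : EReal)] with ω hω
    rw [hω]; exact bot_le
  have : Nonempty C := hC.to_subtype
  let e : EReal ≃o Icc (0 : ℝ) 1 := EReal.expOrderIso.trans ENNReal.orderIsoUnitIntervalBirational
  let H : EReal → ℝ≥0∞ := fun t => ENNReal.ofReal (e t : ℝ)
  have Hmono : Monotone H := fun a b h => ENNReal.ofReal_le_ofReal (e.monotone h)
  have Hinj : Function.Injective H := by
    intro a b h
    have h' : (e a : ℝ) = e b := (ENNReal.ofReal_eq_ofReal_iff (e a).2.1 (e b).2.1).1 h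
    exact e.injective (Subtype.ext h')
  have Hle : ∀ t, H t ≤ 1 := fun t => by
    simpa [H] using ENNReal.ofReal_le_ofReal (e t).2.2
  let S : (ℕ → C) → Ω → EReal := fun s ω => ⨆ n, (s n : Ω →ₘ[μ] EReal) ω
  have Smeas : ∀ s, Measurable (S s) := fun s => Measurable.iSup fun n => (s n).1.measurable
  let F : (ℕ → C) → ℝ≥0∞ := fun s => ∫⁻ ω, H (S s ω) ∂μ
  have Ffin : ∀ s, F s ≠ ∞ := fun s => by
    refine ne_top_of_le_ne_top (measure_ne_top μ univ) ?_
    calc F s ≤ ∫⁻ _, 1 ∂μ := lintegral_mono fun ω => Hle _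
      _ = μ univ := by simp
  obtain ⟨u, -, hu, hmem⟩ := exists_seq_tendsto_sSup (range_nonempty F) (OrderTop.bddAbove _)
  choose s hs using hmem
  let t : ℕ → C := fun n => s n.unpair.1 n.unpair.2
  have hst : ∀ k ω, S (s k) ω ≤ S t ω := fun k ω => iSup_le fun n => by
    simpa [t] using le_iSup (fun j => (t j : Ω →ₘ[μ] EReal) ω) (Nat.pair k n)
  have hFt : sSup (range F) ≤ F t := by
    refine le_of_tendsto' hu fun k => ?_
    rw [← hs k]
    exact lintegral_mono fun ω => Hmono (hst k ω)
  have hcoe : (AEEqFun.mk (S t) (Smeas t).aestronglyMeasurable : Ω →ₘ[μ] EReal) =ᵐ[μ] S t :=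
    AEEqFun.coeFn_mk _ _
  refine ⟨AEEqFun.mk (S t) (Smeas t).aestronglyMeasurable, fun f hf => ?_, fun b hb => ?_⟩
  · let t' : ℕ → C := fun n => Nat.casesOn n ⟨f, hf⟩ t
    have h1 : ∀ ω, S t ω ≤ S t' ω := fun ω => iSup_le fun n => by
      have := le_iSup (fun j => ((t' j).1 : Ω →ₘ[μ] EReal) ω) (n + 1)
      exact this
    have h2 : F t' ≤ F t := (le_sSup (mem_range_self t')).trans hFt
    have h3 := ae_eq_of_ae_le_of_lintegral_le (ae_of_all μ fun ω => Hmono (h1 ω)) (Ffin t)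
      (Hmono.measurable.comp (Smeas t')).aemeasurable h2
    rw [← AEEqFun.coeFn_le]
    filter_upwards [h3, hcoe] with ω hω hc
    rw [hc, Hinj hω]
    have := le_iSup (fun j => ((t' j).1 : Ω →ₘ[μ] EReal) ω) 0
    exact this
  · rw [← AEEqFun.coeFn_le]
    have : ∀ᵐ ω ∂μ, ∀ n, (t n : Ω →ₘ[μ] EReal) ω ≤ b ω :=
      ae_all_iff.2 fun n => AEEqFun.coeFn_le.2 (hb (t n).2)
    filter_upwards [this, hcoe] with ω hω hc
    rw [hc]
    exact iSup_le hω

theorem isLUB_esssup [IsFiniteMeasure μ] (C : Set (Ω →ₘ[μ] EReal)) : IsLUB C (esssup C) :=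
  Classical.epsilon_spec (exists_isLUB C)

end EssSup

section Risk

variable {Ω : Type*} (m : MeasurableSpace Ω) {m0 : MeasurableSpace Ω} (μ : Measure[m0] Ω)

/-- Conditional convex risk measures `ρ : L^φ(𝓔) → L^ψ(𝓕)`; only the values of `ρ` on `L^φ(𝓔)`
matter. -/
structure IsCondConvexRiskMeasure (φ ψ : ℝ≥0 → ℝ≥0∞) (ρ : (Ω →ₘ[μ] ℝ) → (Ω →ₘ[μ] ℝ)) :
    Prop where
  mapsTo : MapsTo ρ (orlicz m0 μ φ) (orlicz m μ ψ)
  antitone : ∀ x ∈ orlicz m0 μ φ, ∀ y ∈ orlicz m0 μ φ, x ≤ y → ρ y ≤ ρ x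
  convex : ∀ x ∈ orlicz m0 μ φ, ∀ y ∈ orlicz m0 μ φ, ∀ l ∈ L0 m μ, 0 ≤ l → l ≤ 1 →
    ρ (l * x + (1 - l) * y) ≤ l * ρ x + (1 - l) * ρ y
  cash : ∀ x ∈ orlicz m0 μ φ, ∀ l ∈ orlicz m μ φ, ρ (x + l) = ρ x - l

variable {μ} in
/-- `ρ̄`, the stable extension of `ρ` from `L^φ(𝓔)` to `L^φ_𝓕(𝓔)`. -/
def extension (φ : ℝ≥0 → ℝ≥0∞) (ρ : (Ω →ₘ[μ] ℝ) → (Ω →ₘ[μ] ℝ)) : (Ω →ₘ[μ] ℝ) → (Ω →ₘ[μ] ℝ) :=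
  stableExt m (orlicz m0 μ φ) ρ

variable {μ} in
/-- `ρ*(y) = esssup {E[xy | 𝓕] - ρ(x) ; x ∈ L^φ(𝓔)}`. -/
def fenchel (φ : ℝ≥0 → ℝ≥0∞) (ρ : (Ω →ₘ[μ] ℝ) → (Ω →ₘ[μ] ℝ)) (y : Ω →ₘ[μ] ℝ) : Ω →ₘ[μ] EReal :=
  esssup {g | ∃ x ∈ orlicz m0 μ φ, g = toE (condE m μ (x * y) - ρ x)}

variable {μ} in
/-- The modular conjugate `f*(y) = esssup {E[xy | 𝓕] - f(x) ; x ∈ L^φ_𝓕(𝓔)}`. -/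
def fenchelModule (φ : ℝ≥0 → ℝ≥0∞) (f : (Ω →ₘ[μ] ℝ) → (Ω →ₘ[μ] ℝ)) (y : Ω →ₘ[μ] ℝ) :
    Ω →ₘ[μ] EReal :=
  esssup {g | ∃ x ∈ orliczModule m μ φ, g = toE (condEExt m μ (x * y) - f x)}

variable {m μ} in
theorem inf_mem_L0pp {e e' : Ω →ₘ[μ] ℝ} (he : e ∈ L0pp m μ) (he' : e' ∈ L0pp m μ) :
    e ⊓ e' ∈ L0pp m μ := by
  obtain ⟨g, hg, h⟩ := he.1
  obtain ⟨g', hg', h'⟩ := he'.1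
  refine ⟨⟨g ⊓ g', @StronglyMeasurable.inf _ _ _ _ m _ _ _ hg hg', (AEEqFun.coeFn_inf e e').trans ?_⟩, ?_⟩
  · filter_upwards [h, h'] with ω h1 h2
    simp [h1, h2]
  filter_upwards [AEEqFun.coeFn_inf e e', he.2, he'.2] with ω h h1 h2
  rw [h]
  exact lt_min h1 h2

/-- The weak topology `σ(E, G)` on `E` for the pairing `⟨x, y⟩ = E[xy | 𝓕]`: the sets
`x + U_{Q,ε}`, where `U_{Q,ε} = {u ; |⟨u, q⟩| ≤ ε for all q ∈ Q}` with `Q ⊆ G` finite and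
`ε ∈ L⁰₊₊(𝓕)`, form a neighbourhood base at `x`. -/
@[reducible]
def weakTopology (E G : Set (Ω →ₘ[μ] ℝ)) : TopologicalSpace E where
  IsOpen O := ∀ x ∈ O, ∃ Q : Finset (Ω →ₘ[μ] ℝ), ↑Q ⊆ G ∧ ∃ e ∈ L0pp m μ,
    ∀ z : E, (∀ q ∈ Q, ∀ᵐ ω ∂μ, |condEExt m μ ((z.1 - x.1) * q) ω| ≤ e ω) → z ∈ O
  isOpen_univ := fun _ _ => ⟨∅, by simp, 1,
    ⟨(aestronglyMeasurable_const (b := (1 : ℝ))).congr AEEqFun.coeFn_one.symm, by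
      filter_upwards [AEEqFun.coeFn_one (β := ℝ) (μ := μ)] with ω h
      rw [h]; exact one_pos⟩, fun _ _ => mem_univ _⟩
  isOpen_inter := by
    classical
    rintro s t hs ht x ⟨hxs, hxt⟩
    obtain ⟨Q, hQ, e, he, h⟩ := hs x hxs
    obtain ⟨Q', hQ', e', he', h'⟩ := ht x hxt
    refine ⟨Q ∪ Q', by simp [hQ, hQ'], e ⊓ e', inf_mem_L0pp he he', fun z hz => ⟨h z ?_, h' z ?_⟩⟩
    · intro q hq
      filter_upwards [hz q (by simp [hq]), AEEqFun.coeFn_inf e e'] with ω h1 h2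
      rw [h2] at h1
      exact h1.trans inf_le_left
    · intro q hq
      filter_upwards [hz q (by simp [hq]), AEEqFun.coeFn_inf e e'] with ω h1 h2
      rw [h2] at h1
      exact h1.trans inf_le_right
  isOpen_sUnion := by
    rintro S hS x ⟨s, hs, hx⟩
    obtain ⟨Q, hQ, e, he, h⟩ := hS s hs x hx
    exact ⟨Q, hQ, e, he, fun z hz => ⟨s, hs, h z hz⟩⟩

/-- `σ(E, G)`-lower semicontinuity of an `L⁰(𝓕)`-valued function `f` on `E`: for every
`c ∈ L⁰(𝓕)` the sublevel set `{x ∈ E ; f(x) ≤ c}` is `σ(E, G)`-closed. -/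
def WeakLSC (E G : Set (Ω →ₘ[μ] ℝ)) (f : (Ω →ₘ[μ] ℝ) → (Ω →ₘ[μ] ℝ)) : Prop :=
  ∀ c ∈ L0 m μ, IsClosed[weakTopology m μ E G] {x : E | f x ≤ c}

end Risk

end CondRisk

end

/-!
The element `ρ x` on a set `A ∈ 𝓕` depends only on `x` on `A`, so `ρ` extends to countable
concatenations and every estimate may be proved on some non-null subset of a given non-null
`B ∈ 𝓕`; an exhaustion then covers `Ω` up to a null set.

The heart of the matter is a conditional separation argument for lower semicontinuous `ρ̄`. Let
`c < ρ x`. Some weak neighbourhood of `x` misses `{ρ̄ ≤ c}`, and after exhausting the sets on which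
an element of it can satisfy `ρ ≤ c`, one finds `D` and finitely many `r ∈ L^{φ*}` such that every
`z` with `ρ z ≤ c` on `D` has a pairing vector `(E[(z - x) r | 𝓕])_r` bounded away from `0` on `D`.
These vectors form a conditionally convex family in a Euclidean space. A minimizing sequence for
the conditional norm converges, by the parallelogram law, to a random vector `v` whose inner
product with each member is strictly positive, and `y = ∑ v_r r` separates `x` from the sublevel
set. Monotonicity of `ρ` gives `y ≥ 0`, and cash invariance turns the separation into
`E[x y | 𝓕] < E[u y | 𝓕] + (ρ u - c) E[y | 𝓕]` for all `u`, so that `- y / E[y | 𝓕]` is feasible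
and its dual value at `x` is at least `c`.

Passing to the extension is locality, and conversely an essential supremum of weakly continuous
affine maps is lower semicontinuous.
-/

noncomputable section

namespace CondRisk

section Exhaustion

variable {Ω : Type*} {m m0 : MeasurableSpace Ω} {μ : Measure[m0] Ω} {ι : Type*}

theorem exists_seq_forall_measure_diff_iUnion_eq_zero [IsFiniteMeasure μ] [Nonempty ι]
    {A : ι → Set Ω} (hA : ∀ i, MeasurableSet (A i)) :
    ∃ s : ℕ → ι, ∀ i, μ (A i \ ⋃ n, A (s n)) = 0 := by
  let F : (ℕ → ι) → ℝ≥0∞ := fun s => μ (⋃ n, A (s n))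
  obtain ⟨u, -, hu, hmem⟩ := exists_seq_tendsto_sSup (range_nonempty F) (OrderTop.bddAbove _)
  choose s hs using hmem
  let t : ℕ → ι := fun n => s n.unpair.1 n.unpair.2
  have hst : ∀ k n, A (s k n) ⊆ ⋃ j, A (t j) := fun k n => by
    simpa [t] using subset_iUnion (fun j => A (t j)) (Nat.pair k n)
  have ht : sSup (range F) ≤ μ (⋃ n, A (t n)) := le_of_tendsto' hu fun k => by
    rw [← hs k]
    exact measure_mono (iUnion_subset (hst k))
  refine ⟨t, fun i => ?_⟩
  let t' : ℕ → ι := fun n => Nat.casesOn n i t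
  have hcons : A i ∪ ⋃ n, A (t n) ⊆ ⋃ n, A (t' n) :=
    union_subset (subset_iUnion (fun n => A (t' n)) 0)
      (iUnion_subset fun n => subset_iUnion (fun n => A (t' n)) (n + 1))
  have hmax : μ (A i ∪ ⋃ n, A (t n)) ≤ μ (⋃ n, A (t n)) :=
    (measure_mono hcons).trans ((le_sSup (mem_range_self (f := F) t')).trans ht)
  rw [← union_sdiff_right, measure_sdiff subset_union_right
    (MeasurableSet.iUnion fun n => hA _).nullMeasurableSet (measure_ne_top _ _)]
  exact tsub_eq_zero_of_le hmax

theorem exists_seq_forall_ae_forall_gt_exists_gt [IsFiniteMeasure μ] [Nonempty ι]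
    {f : ι → Ω → ℝ} (hf : ∀ i, Measurable (f i)) :
    ∃ s : ℕ → ι, ∀ i, ∀ᵐ ω ∂μ, ∀ b, f i ω < b → ∃ n, f (s n) ω < b := by
  have hs (r : ℚ) := exists_seq_forall_measure_diff_iUnion_eq_zero (μ := μ)
    (A := fun i => {ω | f i ω < r}) fun i => hf i measurableSet_Iio
  choose s hs using hs
  obtain ⟨e⟩ : Nonempty (ℕ ≃ ℚ × ℕ) := nonempty_equiv_of_countable
  refine ⟨fun n => s (e n).1 (e n).2, fun i => ?_⟩
  filter_upwards [ae_all_iff.2 fun r : ℚ => measure_eq_zero_iff_ae_notMem.1 (hs r i)] with ω hω b hb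
  obtain ⟨r, hir, hrb⟩ := exists_rat_btwn hb
  obtain ⟨n, hn⟩ := mem_iUnion.1 (not_not.1 fun h => hω r ⟨hir, h⟩)
  obtain ⟨k, hk⟩ := e.surjective (r, n)
  exact ⟨k, by rw [hk]; exact (show f (s r n) ω < r from hn).trans hrb⟩

theorem exists_measure_inter_ne_zero {B : Set Ω} (hB : μ B ≠ 0) {A : ℕ → Set Ω}
    (hA : ∀ᵐ ω ∂μ, ω ∈ B → ∃ n, ω ∈ A n) : ∃ n, μ (B ∩ A n) ≠ 0 := by
  by_contra! h
  refine hB (measure_mono_null_ae (t := ⋃ n, B ∩ A n) ?_ (measure_iUnion_null h))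
  filter_upwards [hA] with ω hω hωB
  exact mem_iUnion.2 <| (hω hωB).imp fun n hn => ⟨hωB, hn⟩

theorem exists_subset_bounded {B : Set Ω} (hBm : MeasurableSet[m] B) (hB : μ B ≠ 0) {f : Ω → ℝ}
    (hf : StronglyMeasurable[m] f) :
    ∃ D ⊆ B, MeasurableSet[m] D ∧ μ D ≠ 0 ∧ ∃ N : ℕ, ∀ ω ∈ D, |f ω| ≤ N := by
  obtain ⟨n, hn⟩ := exists_measure_inter_ne_zero hB (A := fun n : ℕ => {ω | |f ω| ≤ n})
    (ae_of_all _ fun ω _ => exists_nat_ge |f ω|)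
  refine ⟨_, inter_subset_left, hBm.inter ?_, hn, n, fun ω hω => hω.2⟩
  exact (measurable_norm.comp hf.measurable) (measurableSet_Iic (a := (n : ℝ)))

theorem ae_of_forall_exists_subset [IsFiniteMeasure μ] (hm : m ≤ m0) {p : Ω → Prop}
    (h : ∀ B, MeasurableSet[m] B → μ B ≠ 0 →
      ∃ A ⊆ B, MeasurableSet[m] A ∧ μ A ≠ 0 ∧ ∀ᵐ ω ∂μ.restrict A, p ω) :
    ∀ᵐ ω ∂μ, p ω := by
  let ι := {A : Set Ω // MeasurableSet[m] A ∧ ∀ᵐ ω ∂μ.restrict A, p ω}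
  have : Nonempty ι := ⟨∅, @MeasurableSet.empty _ m, by simp⟩
  obtain ⟨s, hs⟩ := exists_seq_forall_measure_diff_iUnion_eq_zero (μ := μ)
    (A := fun A : ι => A.1) fun A => hm _ A.2.1
  have hU : MeasurableSet[m] (⋃ n, (s n).1) := MeasurableSet.iUnion fun n => (s n).2.1
  have hpU : ∀ᵐ ω ∂μ.restrict (⋃ n, (s n).1), p ω :=
    (ae_restrict_iUnion_iff _ _).2 fun n => (s n).2.2
  have hcompl : μ (⋃ n, (s n).1)ᶜ = 0 := by
    by_contra hne
    obtain ⟨A, hAU, hA, hA0, hpA⟩ := h _ hU.compl hne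
    refine hA0 (measure_mono_null (fun ω hω => mem_sdiff_of_mem hω (hAU hω)) (hs ⟨A, hA, hpA⟩))
  filter_upwards [(ae_restrict_iff' (hm _ hU)).1 hpU, measure_eq_zero_iff_ae_notMem.1 hcompl]
    with ω h1 h2
  exact h1 (not_not.1 h2)

theorem ae_restrict_of_forall_exists_subset [IsFiniteMeasure μ] (hm : m ≤ m0) {A : Set Ω}
    (hA : MeasurableSet[m] A) {p : Ω → Prop}
    (h : ∀ B ⊆ A, MeasurableSet[m] B → μ B ≠ 0 →
      ∃ D ⊆ B, MeasurableSet[m] D ∧ μ D ≠ 0 ∧ ∀ᵐ ω ∂μ.restrict D, p ω) :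
    ∀ᵐ ω ∂μ.restrict A, p ω := by
  refine ae_of_forall_exists_subset hm fun B hBm hB => ?_
  rw [Measure.restrict_apply (hm _ hBm)] at hB
  obtain ⟨D, hDBA, hDm, hD, hpD⟩ := h _ inter_subset_right (hBm.inter hA) hB
  have hDA : D ⊆ A := hDBA.trans inter_subset_right
  refine ⟨D, hDBA.trans inter_subset_left, hDm, ?_, ?_⟩
  · rwa [Measure.restrict_eq_self μ hDA]
  · rwa [Measure.restrict_restrict_of_subset hDA]

end Exhaustion

section Ring

variable {Ω R : Type*} {m0 : MeasurableSpace Ω} {μ : Measure[m0] Ω} [TopologicalSpace R]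
  [CommRing R] [IsTopologicalRing R]

theorem mul_add_class (x y z : Ω →ₘ[μ] R) : x * (y + z) = x * y + x * z :=
  AEEqFun.toGerm_injective <| by
    simp only [AEEqFun.mul_toGerm, AEEqFun.add_toGerm, mul_add]

theorem zero_mul_class (x : Ω →ₘ[μ] R) : 0 * x = 0 :=
  AEEqFun.toGerm_injective <| by
    simp only [AEEqFun.mul_toGerm, AEEqFun.zero_toGerm, zero_mul]

instance instCommRing : CommRing (Ω →ₘ[μ] R) :=
  { (inferInstance : AddCommGroup (Ω →ₘ[μ] R)), (inferInstance : CommMonoid (Ω →ₘ[μ] R)) with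
    left_distrib := mul_add_class
    right_distrib := fun x y z => by simp only [mul_comm _ z, mul_add_class]
    zero_mul := zero_mul_class
    mul_zero := fun x => (mul_comm x 0).trans (zero_mul_class x) }

end Ring

section Gluing

variable {Ω : Type*} {m m0 : MeasurableSpace Ω} {μ : Measure[m0] Ω} {A : Set Ω}
  {x x' y y' : Ω →ₘ[μ] ℝ}

theorem add_congr_on (hx : x =ᵐ[μ.restrict A] x') (hy : y =ᵐ[μ.restrict A] y') :
    ⇑(x + y) =ᵐ[μ.restrict A] ⇑(x' + y') :=
  (AEEqFun.coeFn_add x y).restrict.trans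
    ((hx.add hy).trans (AEEqFun.coeFn_add x' y').restrict.symm)

theorem sub_congr_on (hx : x =ᵐ[μ.restrict A] x') (hy : y =ᵐ[μ.restrict A] y') :
    ⇑(x - y) =ᵐ[μ.restrict A] ⇑(x' - y') :=
  (AEEqFun.coeFn_sub x y).restrict.trans
    ((hx.sub hy).trans (AEEqFun.coeFn_sub x' y').restrict.symm)

theorem mul_congr_on (hx : x =ᵐ[μ.restrict A] x') (hy : y =ᵐ[μ.restrict A] y') :
    ⇑(x * y) =ᵐ[μ.restrict A] ⇑(x' * y') :=
  (AEEqFun.coeFn_mul x y).restrict.trans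
    ((hx.mul hy).trans (AEEqFun.coeFn_mul x' y').restrict.symm)

theorem coeFn_convexComb (l x y : Ω →ₘ[μ] ℝ) :
    ∀ᵐ ω ∂μ, (l * x + (1 - l) * y) ω = l ω * x ω + (1 - l ω) * y ω := by
  filter_upwards [AEEqFun.coeFn_add (l * x) ((1 - l) * y), AEEqFun.coeFn_mul l x,
    AEEqFun.coeFn_mul (1 - l) y, AEEqFun.coeFn_sub 1 l, AEEqFun.coeFn_one (β := ℝ) (μ := μ)]
    with ω h1 h2 h3 h4 h5
  simp only [h1, h2, h3, h4, h5, Pi.add_apply, Pi.mul_apply, Pi.sub_apply, Pi.one_apply]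

theorem zero_le_iff_ae : 0 ≤ x ↔ ∀ᵐ ω ∂μ, 0 ≤ x ω := by
  rw [← AEEqFun.coeFn_le]
  exact eventually_congr (AEEqFun.coeFn_zero.mono fun ω h => by rw [h, Pi.zero_apply])

theorem le_one_iff_ae : x ≤ 1 ↔ ∀ᵐ ω ∂μ, x ω ≤ 1 := by
  rw [← AEEqFun.coeFn_le]
  exact eventually_congr (AEEqFun.coeFn_one.mono fun ω h => by rw [h, Pi.one_apply])

theorem mem_L0_of_ae_eq {f : Ω → ℝ} (hf : StronglyMeasurable[m] f) (h : x =ᵐ[μ] f) :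
    x ∈ L0 m μ :=
  ⟨f, hf, h⟩

theorem mem_L0_top (x : Ω →ₘ[μ] ℝ) : x ∈ L0 m0 μ := x.aestronglyMeasurable

theorem exists_mem_L0_ae_eq (hm : m ≤ m0) {f : Ω → ℝ} (hf : StronglyMeasurable[m] f) :
    ∃ x ∈ L0 m μ, x =ᵐ[μ] f :=
  ⟨AEEqFun.mk f (hf.mono hm).aestronglyMeasurable,
    mem_L0_of_ae_eq hf (AEEqFun.coeFn_mk _ _), AEEqFun.coeFn_mk _ _⟩

theorem add_mem_L0 (hx : x ∈ L0 m μ) (hy : y ∈ L0 m μ) : x + y ∈ L0 m μ :=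
  (AEStronglyMeasurable.add hx hy).congr (AEEqFun.coeFn_add x y).symm

theorem sub_mem_L0 (hx : x ∈ L0 m μ) (hy : y ∈ L0 m μ) : x - y ∈ L0 m μ :=
  (AEStronglyMeasurable.sub hx hy).congr (AEEqFun.coeFn_sub x y).symm

theorem mul_mem_L0 (hx : x ∈ L0 m μ) (hy : y ∈ L0 m μ) : x * y ∈ L0 m μ :=
  (AEStronglyMeasurable.mul hx hy).congr (AEEqFun.coeFn_mul x y).symm

theorem one_mem_L0 : (1 : Ω →ₘ[μ] ℝ) ∈ L0 m μ :=
  mem_L0_of_ae_eq stronglyMeasurable_const AEEqFun.coeFn_one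

variable (μ) in
/-- The class of the indicator function `1_A`. -/
def ind (hA : MeasurableSet A) : Ω →ₘ[μ] ℝ :=
  AEEqFun.mk (A.indicator 1) (measurable_one.indicator hA).aestronglyMeasurable

theorem coeFn_ind (hA : MeasurableSet A) : ind μ hA =ᵐ[μ] A.indicator 1 := AEEqFun.coeFn_mk _ _

theorem ind_eq_one_on (hA : MeasurableSet A) : ind μ hA =ᵐ[μ.restrict A] (1 : Ω →ₘ[μ] ℝ) := by
  rw [EventuallyEq, ae_restrict_iff' hA]
  filter_upwards [coeFn_ind hA, AEEqFun.coeFn_one (β := ℝ) (μ := μ)] with ω h h1 hω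
  rw [h, h1, indicator_of_mem hω]

theorem ind_eq_zero_on_compl (hA : MeasurableSet A) :
    ind μ hA =ᵐ[μ.restrict Aᶜ] (0 : Ω →ₘ[μ] ℝ) := by
  rw [EventuallyEq, ae_restrict_iff' hA.compl]
  filter_upwards [coeFn_ind hA, AEEqFun.coeFn_zero (β := ℝ) (μ := μ)] with ω h h0 hω
  rw [h, h0, indicator_of_notMem hω, Pi.zero_apply]

theorem ind_nonneg (hA : MeasurableSet A) : 0 ≤ ind μ hA :=
  zero_le_iff_ae.2 <| (coeFn_ind hA).mono fun ω h =>
    h ▸ indicator_nonneg (fun _ _ => zero_le_one) ω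

theorem ind_le_one (hA : MeasurableSet A) : ind μ hA ≤ 1 :=
  le_one_iff_ae.2 <| (coeFn_ind hA).mono fun ω h =>
    h ▸ indicator_le_self' (fun _ _ => zero_le_one) ω

theorem ind_mem_L0 (hA : MeasurableSet[m] A) (hA' : MeasurableSet A) : ind μ hA' ∈ L0 m μ :=
  mem_L0_of_ae_eq (stronglyMeasurable_one.indicator hA) (coeFn_ind hA')

/-- The element which is `x` on `A` and `y` off `A`. It is written as a combination
`1_A x + (1 - 1_A) y` in order to be subject to the conditional convexity of risk measures. -/
def glue (hA : MeasurableSet A) (x y : Ω →ₘ[μ] ℝ) : Ω →ₘ[μ] ℝ :=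
  ind μ hA * x + (1 - ind μ hA) * y

theorem glue_eq_on (hA : MeasurableSet A) (x y : Ω →ₘ[μ] ℝ) :
    glue hA x y =ᵐ[μ.restrict A] x := by
  have h := ind_eq_one_on (μ := μ) hA
  have := add_congr_on (mul_congr_on h (ae_eq_refl ⇑x))
    (mul_congr_on (sub_congr_on (x := 1) ae_eq_rfl h) (ae_eq_refl ⇑y))
  rwa [sub_self, zero_mul, one_mul, add_zero] at this

theorem glue_eq_on_compl (hA : MeasurableSet A) (x y : Ω →ₘ[μ] ℝ) :
    glue hA x y =ᵐ[μ.restrict Aᶜ] y := by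
  have h := ind_eq_zero_on_compl (μ := μ) hA
  have := add_congr_on (mul_congr_on h (ae_eq_refl ⇑x))
    (mul_congr_on (sub_congr_on (x := 1) ae_eq_rfl h) (ae_eq_refl ⇑y))
  rwa [sub_zero, zero_mul, one_mul, zero_add] at this

theorem ae_of_ae_on_of_ae_on_compl (hA : MeasurableSet A) {p : Ω → Prop}
    (h : ∀ᵐ ω ∂μ.restrict A, p ω) (h' : ∀ᵐ ω ∂μ.restrict Aᶜ, p ω) : ∀ᵐ ω ∂μ, p ω := by
  filter_upwards [(ae_restrict_iff' hA).1 h, (ae_restrict_iff' hA.compl).1 h'] with ω h1 h2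
  exact (em (ω ∈ A)).elim h1 h2

theorem glue_eq_right (hA : MeasurableSet A) (h : x =ᵐ[μ.restrict A] y) : glue hA x y = y :=
  AEEqFun.ext <| ae_of_ae_on_of_ae_on_compl hA ((glue_eq_on hA x y).trans h)
    (glue_eq_on_compl hA x y)

theorem glue_le {z : Ω →ₘ[μ] ℝ} (hA : MeasurableSet A) (hx : x ≤ᵐ[μ.restrict A] z)
    (hy : y ≤ᵐ[μ.restrict Aᶜ] z) : glue hA x y ≤ z :=
  AEEqFun.coeFn_le.1 <| ae_of_ae_on_of_ae_on_compl hA ((glue_eq_on hA x y).trans_le hx)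
    ((glue_eq_on_compl hA x y).trans_le hy)

theorem glue_mem_L0 (hA : MeasurableSet[m] A) (hA' : MeasurableSet A) (hx : x ∈ L0 m μ)
    (hy : y ∈ L0 m μ) : glue hA' x y ∈ L0 m μ :=
  add_mem_L0 (mul_mem_L0 (ind_mem_L0 hA hA') hx)
    (mul_mem_L0 (sub_mem_L0 one_mem_L0 (ind_mem_L0 hA hA')) hy)

end Gluing

section Young

variable {φ : ℝ≥0 → ℝ≥0∞}

theorem conj_mono (φ : ℝ≥0 → ℝ≥0∞) : Monotone (conj φ) := fun a b hab =>
  iSup_mono fun t => by gcongr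

theorem conj_zero (φ : ℝ≥0 → ℝ≥0∞) : conj φ 0 = 0 := by simp [conj]

theorem mul_le_add_conj (φ : ℝ≥0 → ℝ≥0∞) (t s : ℝ≥0) : (t : ℝ≥0∞) * s ≤ φ t + conj φ s :=
  tsub_le_iff_left.1 (le_iSup (fun t : ℝ≥0 => (t : ℝ≥0∞) * s - φ t) t)

theorem IsYoung.exists_pos_lt_top (hφ : IsYoung φ) : ∃ t, 0 < t ∧ φ t < ∞ :=
  ((eventually_mem_nhdsWithin (s := Ioi 0)).and
    (hφ.finite_near_zero.filter_mono nhdsWithin_le_nhds)).exists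

theorem IsYoung.map_mul_le (hφ : IsYoung φ) {c : ℝ≥0} (hc : c ≤ 1) (t : ℝ≥0) :
    φ (c * t) ≤ c * φ t := by
  have h := hφ.convex.2 (mem_univ 0) (mem_univ t) (zero_le (a := 1 - c)) (zero_le (a := c))
    (tsub_add_cancel_of_le hc)
  simpa only [hφ.map_zero, smul_zero, zero_add, ENNReal.smul_def, smul_eq_mul, mul_zero] using h

theorem IsYoung.exists_pos_conj_lt_top (hφ : IsYoung φ) : ∃ s, 0 < s ∧ conj φ s < ∞ := by
  obtain ⟨r, hr, hr0⟩ := ((hφ.tendsto_top.eventually (lt_mem_nhds ENNReal.one_lt_top)).and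
    (eventually_gt_atTop 0)).exists
  refine ⟨r⁻¹, inv_pos.2 hr0, lt_of_le_of_lt (iSup_le fun t => ?_) ENNReal.one_lt_top⟩
  rw [tsub_le_iff_right, ← ENNReal.coe_mul, ← div_eq_mul_inv]
  rcases le_total t r with htr | hrt
  · exact le_add_right (ENNReal.coe_le_one_iff.2 (div_le_one_of_le₀ htr zero_le))
  · have ht0 : t ≠ 0 := (hr0.trans_le hrt).ne'
    have hslope : 1 ≤ ((r / t : ℝ≥0) : ℝ≥0∞) * φ t := by
      have h := hφ.map_mul_le (div_le_one_of_le₀ hrt zero_le) t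
      rw [div_mul_cancel₀ _ ht0] at h
      exact hr.le.trans h
    refine le_add_left ?_
    calc ((t / r : ℝ≥0) : ℝ≥0∞) ≤ (t / r : ℝ≥0) * ((r / t : ℝ≥0) * φ t) :=
          le_mul_of_one_le_right' hslope
      _ = φ t := by
          rw [← mul_assoc, ← ENNReal.coe_mul, div_mul_div_cancel₀ hr0.ne', div_self ht0,
            ENNReal.coe_one, one_mul]

end Young

section Orlicz

variable {Ω : Type*} {m m0 : MeasurableSpace Ω} {μ : Measure[m0] Ω} {φ : ℝ≥0 → ℝ≥0∞}
  {x y z l : Ω →ₘ[μ] ℝ}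

theorem measurable_comp_nnnorm_div_const (hφ : Monotone φ) (x : Ω →ₘ[μ] ℝ) (c : ℝ≥0) :
    Measurable fun ω => φ (‖x ω‖₊ / c) :=
  hφ.measurable.comp (x.measurable.nnnorm.div_const c)

theorem mem_orlicz_of_le_max (hφ : Monotone φ) (hx : x ∈ orlicz m0 μ φ) (hy : y ∈ orlicz m0 μ φ)
    (hz : z ∈ L0 m μ) (C : ℝ≥0) (h : ∀ᵐ ω ∂μ, |z ω| ≤ C * max |x ω| |y ω|) :
    z ∈ orlicz m μ φ := by
  obtain ⟨-, c, hc, hxc⟩ := hx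
  obtain ⟨-, d, hd, hyd⟩ := hy
  have hfin : ∫⁻ ω, (φ (‖x ω‖₊ / c) + φ (‖y ω‖₊ / d)) ∂μ < ∞ := by
    rw [lintegral_add_left (measurable_comp_nnnorm_div_const hφ x c)]
    exact ENNReal.add_lt_top.2 ⟨hxc, hyd⟩
  refine ⟨hz, (C + 1) * max c d, by positivity, (lintegral_mono_ae ?_).trans_lt hfin⟩
  filter_upwards [h] with ω hω
  have hdiv : ‖z ω‖₊ / ((C + 1) * max c d) ≤ max (‖x ω‖₊ / c) (‖y ω‖₊ / d) := by
    have hmax : max ‖x ω‖₊ ‖y ω‖₊ ≤ max (‖x ω‖₊ / c) (‖y ω‖₊ / d) * max c d :=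
      max_le
        ((div_mul_cancel₀ ‖x ω‖₊ hc.ne').symm.le.trans (by gcongr <;> exact le_max_left _ _))
        ((div_mul_cancel₀ ‖y ω‖₊ hd.ne').symm.le.trans (by gcongr <;> exact le_max_right _ _))
    rw [div_le_iff₀ (by positivity)]
    calc ‖z ω‖₊ ≤ C * max ‖x ω‖₊ ‖y ω‖₊ := by
          rw [← NNReal.coe_le_coe]; push_cast; exact hω
      _ ≤ (C + 1) * (max (‖x ω‖₊ / c) (‖y ω‖₊ / d) * max c d) := by gcongr; exact le_self_add
      _ = _ := by ring
  calc φ (‖z ω‖₊ / ((C + 1) * max c d)) ≤ φ (max (‖x ω‖₊ / c) (‖y ω‖₊ / d)) := hφ hdiv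
    _ = max (φ (‖x ω‖₊ / c)) (φ (‖y ω‖₊ / d)) := hφ.map_max
    _ ≤ _ := max_le_add_of_nonneg zero_le zero_le

theorem mem_orlicz_of_bounded [IsFiniteMeasure μ] (hφ : Monotone φ) (h0 : ∃ t, 0 < t ∧ φ t < ∞)
    (hz : z ∈ L0 m μ) (C : ℝ≥0) (h : ∀ᵐ ω ∂μ, |z ω| ≤ C) : z ∈ orlicz m μ φ := by
  obtain ⟨t, ht, hφt⟩ := h0
  refine ⟨hz, (C + 1) / t, by positivity,
    (lintegral_mono_ae (g := fun _ => φ t) ?_).trans_lt ?_⟩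
  · filter_upwards [h] with ω hω
    have hzC : ‖z ω‖₊ ≤ C := by rw [← NNReal.coe_le_coe]; exact hω
    refine hφ ?_
    rw [div_le_iff₀ (by positivity), mul_div_cancel₀ _ ht.ne']
    exact hzC.trans le_self_add
  · rw [lintegral_const]
    exact ENNReal.mul_lt_top hφt (measure_lt_top _ _)

theorem orlicz_mono_measurableSpace (hx : x ∈ orlicz m μ φ) : x ∈ orlicz m0 μ φ :=
  ⟨mem_L0_top _, hx.2⟩

theorem zero_mem_orlicz (hφ : φ 0 = 0) : (0 : Ω →ₘ[μ] ℝ) ∈ orlicz m0 μ φ := by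
  refine ⟨mem_L0_top _, 1, one_pos, ?_⟩
  have h0 : (fun ω => φ (‖(0 : Ω →ₘ[μ] ℝ) ω‖₊ / 1)) =ᵐ[μ] 0 :=
    (AEEqFun.coeFn_zero (β := ℝ)).mono fun ω h => by
      simp only [h, Pi.zero_apply, nnnorm_zero, zero_div, hφ]
  rw [lintegral_congr_ae h0, lintegral_zero_fun]
  exact ENNReal.zero_lt_top

theorem add_mem_orlicz (hφ : Monotone φ) (hx : x ∈ orlicz m0 μ φ) (hy : y ∈ orlicz m0 μ φ) :
    x + y ∈ orlicz m0 μ φ := by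
  refine mem_orlicz_of_le_max hφ hx hy (mem_L0_top _) 2 ?_
  filter_upwards [AEEqFun.coeFn_add x y] with ω h
  rw [h, Pi.add_apply, NNReal.coe_ofNat, two_mul]
  exact (abs_add_le _ _).trans (add_le_add (le_max_left _ _) (le_max_right _ _))

theorem sub_mem_orlicz (hφ : Monotone φ) (hx : x ∈ orlicz m0 μ φ) (hy : y ∈ orlicz m0 μ φ) :
    x - y ∈ orlicz m0 μ φ := by
  refine mem_orlicz_of_le_max hφ hx hy (mem_L0_top _) 2 ?_
  filter_upwards [AEEqFun.coeFn_sub x y] with ω h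
  rw [h, Pi.sub_apply, NNReal.coe_ofNat, two_mul]
  exact (abs_sub _ _).trans (add_le_add (le_max_left _ _) (le_max_right _ _))

theorem mul_mem_orlicz_of_bounded (hφ : Monotone φ) (C : ℝ≥0) (hl : ∀ᵐ ω ∂μ, |l ω| ≤ C)
    (hx : x ∈ orlicz m0 μ φ) : l * x ∈ orlicz m0 μ φ := by
  refine mem_orlicz_of_le_max hφ hx hx (mem_L0_top _) C ?_
  filter_upwards [hl, AEEqFun.coeFn_mul l x] with ω h hmul
  rw [hmul, Pi.mul_apply, abs_mul, max_self]
  gcongr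

theorem convexComb_mem_orlicz (hφ : Monotone φ) (hl0 : 0 ≤ l) (hl1 : l ≤ 1)
    (hx : x ∈ orlicz m0 μ φ) (hy : y ∈ orlicz m0 μ φ) : l * x + (1 - l) * y ∈ orlicz m0 μ φ := by
  refine mem_orlicz_of_le_max hφ hx hy (mem_L0_top _) 1 ?_
  filter_upwards [coeFn_convexComb l x y, zero_le_iff_ae.1 hl0, le_one_iff_ae.1 hl1]
    with ω h h0 h1
  calc |(l * x + (1 - l) * y) ω| ≤ l ω * |x ω| + (1 - l ω) * |y ω| := by
        rw [h]
        refine (abs_add_le _ _).trans_eq ?_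
        rw [abs_mul, abs_mul, abs_of_nonneg h0, abs_of_nonneg (sub_nonneg.2 h1)]
    _ ≤ l ω * max |x ω| |y ω| + (1 - l ω) * max |x ω| |y ω| :=
        add_le_add (mul_le_mul_of_nonneg_left (le_max_left _ _) h0)
          (mul_le_mul_of_nonneg_left (le_max_right _ _) (sub_nonneg.2 h1))
    _ = (1 : ℝ≥0) * max |x ω| |y ω| := by rw [NNReal.coe_one]; ring

theorem glue_mem_orlicz (hφ : Monotone φ) {A : Set Ω} (hA : MeasurableSet A)
    (hx : x ∈ orlicz m0 μ φ) (hy : y ∈ orlicz m0 μ φ) : glue hA x y ∈ orlicz m0 μ φ :=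
  convexComb_mem_orlicz hφ (ind_nonneg hA) (ind_le_one hA) hx hy

theorem integrable_mul_of_mem_orlicz (hφ : Monotone φ) (hx : x ∈ orlicz m0 μ φ)
    (hy : y ∈ orlicz m0 μ (conj φ)) : Integrable ↑(x * y) μ := by
  obtain ⟨-, c, hc, hxc⟩ := hx
  obtain ⟨-, d, hd, hyd⟩ := hy
  refine ⟨AEEqFun.aestronglyMeasurable _, ?_⟩
  have hyoung : ∀ᵐ ω ∂μ, ‖(x * y) ω‖ₑ ≤
      ((c * d : ℝ≥0) : ℝ≥0∞) * (φ (‖x ω‖₊ / c) + conj φ (‖y ω‖₊ / d)) := by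
    filter_upwards [AEEqFun.coeFn_mul x y] with ω hω
    calc ‖(x * y) ω‖ₑ = ((c * d : ℝ≥0) : ℝ≥0∞) *
          (((‖x ω‖₊ / c : ℝ≥0) : ℝ≥0∞) * ((‖y ω‖₊ / d : ℝ≥0) : ℝ≥0∞)) := by
          rw [hω, Pi.mul_apply, ← ENNReal.coe_mul, ← ENNReal.coe_mul, enorm_eq_nnnorm, nnnorm_mul]
          congr 1
          field_simp
      _ ≤ _ := by gcongr; exact mul_le_add_conj φ _ _
  refine (lintegral_mono_ae hyoung).trans_lt ?_
  rw [lintegral_const_mul' _ _ ENNReal.coe_ne_top,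
    lintegral_add_left (measurable_comp_nnnorm_div_const hφ x c)]
  exact ENNReal.mul_lt_top ENNReal.coe_lt_top (ENNReal.add_lt_top.2 ⟨hxc, hyd⟩)

end Orlicz

section Hull

variable {Ω : Type*} {m m0 : MeasurableSpace Ω} {μ : Measure[m0] Ω} {A B : ℕ → Set Ω}

theorem isPartition_preimage_singleton {N : Ω → ℕ} (hN : Measurable[m] N) :
    IsPartition m fun k => N ⁻¹' {k} :=
  ⟨fun k => hN (measurableSet_singleton k),
    fun _ _ hij => Disjoint.preimage _ (disjoint_singleton.2 hij),
    iUnion_eq_univ_iff.2 fun ω => ⟨N ω, rfl⟩⟩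

theorem isPartition_disjointed (hA : ∀ k, MeasurableSet[m] (A k)) (hU : ⋃ k, A k = univ) :
    IsPartition m (disjointed A) :=
  ⟨fun k => MeasurableSet.disjointed hA k, disjoint_disjointed A, (iUnion_disjointed).trans hU⟩

theorem IsPartition.exists_mem (hA : IsPartition m A) (ω : Ω) : ∃ k, ω ∈ A k :=
  mem_iUnion.1 (hA.2.2 ▸ mem_univ ω)

theorem IsPartition.ae_restrict_of_forall (hA : IsPartition m A) {p : Ω → Prop} {D : Set Ω}
    (h : ∀ k, ∀ᵐ ω ∂μ.restrict (D ∩ A k), p ω) : ∀ᵐ ω ∂μ.restrict D, p ω := by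
  rw [← inter_univ D, ← hA.2.2, inter_iUnion, ae_restrict_iUnion_iff]
  exact h

theorem IsPartition.ae_of_forall (hA : IsPartition m A) {p : Ω → Prop}
    (h : ∀ k, ∀ᵐ ω ∂μ.restrict (A k), p ω) : ∀ᵐ ω ∂μ, p ω := by
  rw [← Measure.restrict_univ (μ := μ), ← hA.2.2, ae_restrict_iUnion_iff]
  exact h

theorem IsPartition.inter (hA : IsPartition m A) (hB : IsPartition m B) :
    IsPartition m fun n => A n.unpair.1 ∩ B n.unpair.2 := by
  refine ⟨fun n => (hA.1 _).inter (hB.1 _), fun i j hij => ?_, iUnion_eq_univ_iff.2 fun ω => ?_⟩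
  · by_cases h : i.unpair.1 = j.unpair.1
    · have h' : i.unpair.2 ≠ j.unpair.2 := fun h' => hij <| by
        rw [← Nat.pair_unpair i, ← Nat.pair_unpair j, h, h']
      exact (hB.2.1 h').mono inter_subset_right inter_subset_right
    · exact (hA.2.1 h).mono inter_subset_left inter_subset_left
  · obtain ⟨k, hk⟩ := hA.exists_mem ω
    obtain ⟨l, hl⟩ := hB.exists_mem ω
    exact ⟨Nat.pair k l, by simpa only [Nat.unpair_pair] using ⟨hk, hl⟩⟩

theorem IsPartition.exists_measurable_eqOn (hA : IsPartition m A) {g : ℕ → Ω → ℝ}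
    (hg : ∀ k, Measurable[m] (g k)) :
    ∃ f : Ω → ℝ, Measurable[m] f ∧ ∀ k, EqOn f (g k) (A k) :=
  exists_measurable_piecewise A hA.1 g hg fun _ _ hij _ hω =>
    absurd hω.2 (disjoint_left.1 (hA.2.1 hij) hω.1)

theorem isConcat_iff (hA : ∀ k, MeasurableSet (A k)) {xs : ℕ → (Ω →ₘ[μ] ℝ)} {x : Ω →ₘ[μ] ℝ} :
    IsConcat A xs x ↔ ∀ k, x =ᵐ[μ.restrict (A k)] xs k :=
  forall_congr' fun k => (ae_restrict_iff' (hA k)).symm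

theorem exists_eq_on_partition (hA : IsPartition m0 A) (xs : ℕ → (Ω →ₘ[μ] ℝ)) :
    ∃ x : Ω →ₘ[μ] ℝ, ∀ k, x =ᵐ[μ.restrict (A k)] xs k := by
  obtain ⟨f, hf, h⟩ := hA.exists_measurable_eqOn fun k => (xs k).measurable
  refine ⟨AEEqFun.mk f hf.aestronglyMeasurable, fun k => ?_⟩
  exact (AEEqFun.coeFn_mk f _).restrict.trans ((h k).aeEq_restrict (hA.1 k))

theorem eq_on_mono {S T : Set Ω} (hST : S ⊆ T) {x y : Ω →ₘ[μ] ℝ} (h : x =ᵐ[μ.restrict T] y) :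
    x =ᵐ[μ.restrict S] y :=
  ae_restrict_of_ae_restrict_of_subset hST h

variable {D D₁ D₂ D₃ : Set (Ω →ₘ[μ] ℝ)} {f : (Ω →ₘ[μ] ℝ) → (Ω →ₘ[μ] ℝ)} {x y : Ω →ₘ[μ] ℝ}

variable (m) in
/-- The countable concatenation hull of `D`: the elements `∑ₖ 1_{A k} xs k` with `xs k ∈ D` and an
`m`-measurable partition `A`. -/
def hull (D : Set (Ω →ₘ[μ] ℝ)) : Set (Ω →ₘ[μ] ℝ) :=
  {x | ∃ (A : ℕ → Set Ω) (xs : ℕ → (Ω →ₘ[μ] ℝ)),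
    IsPartition m A ∧ (∀ k, xs k ∈ D) ∧ ∀ k, x =ᵐ[μ.restrict (A k)] xs k}

variable (m) in
/-- Locality of `f` on `D`: on an `m`-measurable set, the values of `f x` depend only on the values
of `x` on that set. -/
def IsLocalOn (D : Set (Ω →ₘ[μ] ℝ)) (f : (Ω →ₘ[μ] ℝ) → (Ω →ₘ[μ] ℝ)) : Prop :=
  ∀ x ∈ D, ∀ y ∈ D, ∀ A, MeasurableSet[m] A → x =ᵐ[μ.restrict A] y → f x =ᵐ[μ.restrict A] f y

theorem subset_hull (D : Set (Ω →ₘ[μ] ℝ)) : D ⊆ hull m D := fun x hx =>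
  ⟨_, fun _ => x, isPartition_preimage_singleton (@measurable_const _ _ _ m 0), fun _ => hx,
    fun _ => ae_eq_rfl⟩

theorem exists_common_partition (hx : x ∈ hull m D₁) (hy : y ∈ hull m D₂) :
    ∃ (A : ℕ → Set Ω) (xs ys : ℕ → (Ω →ₘ[μ] ℝ)), IsPartition m A ∧
      (∀ k, xs k ∈ D₁ ∧ x =ᵐ[μ.restrict (A k)] xs k) ∧
      ∀ k, ys k ∈ D₂ ∧ y =ᵐ[μ.restrict (A k)] ys k := by
  obtain ⟨A, xs, hA, hxs, hx⟩ := hx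
  obtain ⟨B, ys, hB, hys, hy⟩ := hy
  exact ⟨_, fun n => xs n.unpair.1, fun n => ys n.unpair.2, hA.inter hB,
    fun n => ⟨hxs _, eq_on_mono inter_subset_left (hx _)⟩,
    fun n => ⟨hys _, eq_on_mono inter_subset_right (hy _)⟩⟩

theorem sub_mem_hull (hD : ∀ x ∈ D₁, ∀ y ∈ D₂, x - y ∈ D₃) (hx : x ∈ hull m D₁)
    (hy : y ∈ hull m D₂) : x - y ∈ hull m D₃ := by
  obtain ⟨A, xs, ys, hA, hxs, hys⟩ := exists_common_partition hx hy
  exact ⟨A, fun k => xs k - ys k, hA, fun k => hD _ (hxs k).1 _ (hys k).1,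
    fun k => sub_congr_on (hxs k).2 (hys k).2⟩

theorem mul_mem_hull (hD : ∀ x ∈ D₁, ∀ y ∈ D₂, x * y ∈ D₃) (hx : x ∈ hull m D₁)
    (hy : y ∈ hull m D₂) : x * y ∈ hull m D₃ := by
  obtain ⟨A, xs, ys, hA, hxs, hys⟩ := exists_common_partition hx hy
  exact ⟨A, fun k => xs k * ys k, hA, fun k => hD _ (hxs k).1 _ (hys k).1,
    fun k => mul_congr_on (hxs k).2 (hys k).2⟩

theorem exists_subset_eq_of_mem_hull (hx : x ∈ hull m D) {S : Set Ω} (hSm : MeasurableSet[m] S)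
    (hS : μ S ≠ 0) :
    ∃ T ⊆ S, MeasurableSet[m] T ∧ μ T ≠ 0 ∧ ∃ y ∈ D, x =ᵐ[μ.restrict T] y := by
  obtain ⟨A, xs, hA, hxs, hx⟩ := hx
  obtain ⟨n, hn⟩ := exists_measure_inter_ne_zero hS (ae_of_all μ fun ω _ => hA.exists_mem ω)
  exact ⟨_, inter_subset_left, hSm.inter (hA.1 n), hn, xs n, hxs n,
    eq_on_mono inter_subset_right (hx n)⟩

theorem stableExt_spec (hm : m ≤ m0) (hx : x ∈ hull m D) :
    ∃ (A : ℕ → Set Ω) (xs : ℕ → (Ω →ₘ[μ] ℝ)), IsPartition m A ∧ (∀ k, xs k ∈ D) ∧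
      (∀ k, x =ᵐ[μ.restrict (A k)] xs k) ∧
      ∀ k, stableExt m D f x =ᵐ[μ.restrict (A k)] f (xs k) := by
  have hex : ∃ z, ∃ (A : ℕ → Set Ω) (xs : ℕ → (Ω →ₘ[μ] ℝ)), IsPartition m A ∧ (∀ k, xs k ∈ D) ∧
      IsConcat A xs x ∧ IsConcat A (fun k => f (xs k)) z := by
    obtain ⟨A, xs, hA, hxs, hx⟩ := hx
    have hAm k := hm _ (hA.1 k)
    obtain ⟨z, hz⟩ := exists_eq_on_partition ⟨hAm, hA.2⟩ fun k => f (xs k)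
    exact ⟨z, A, xs, hA, hxs, (isConcat_iff hAm).2 hx, (isConcat_iff hAm).2 hz⟩
  obtain ⟨A, xs, hA, hxs, hx, hfx⟩ := Classical.epsilon_spec hex
  have hAm k := hm _ (hA.1 k)
  exact ⟨A, xs, hA, hxs, (isConcat_iff hAm).1 hx, (isConcat_iff hAm).1 hfx⟩

theorem stableExt_eq_on (hm : m ≤ m0) (hf : IsLocalOn m D f) (hx : x ∈ hull m D) (hy : y ∈ D)
    {S : Set Ω} (hS : MeasurableSet[m] S) (h : x =ᵐ[μ.restrict S] y) :
    stableExt m D f x =ᵐ[μ.restrict S] f y := by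
  obtain ⟨A, xs, hA, hxs, hx, hfx⟩ := stableExt_spec (f := f) hm hx
  refine hA.ae_restrict_of_forall fun k => ?_
  have hxy : xs k =ᵐ[μ.restrict (S ∩ A k)] y :=
    (eq_on_mono inter_subset_right (hx k)).symm.trans
      (eq_on_mono inter_subset_left h)
  exact (eq_on_mono inter_subset_right (hfx k)).trans
    (hf _ (hxs k) _ hy _ (hS.inter (hA.1 k)) hxy)

theorem stableExt_eq (hm : m ≤ m0) (hf : IsLocalOn m D f) (hx : x ∈ D) :
    stableExt m D f x = f x :=
  AEEqFun.ext <| by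
    simpa only [Measure.restrict_univ] using
      stableExt_eq_on hm hf (subset_hull D hx) hx (@MeasurableSet.univ _ m) ae_eq_rfl

theorem isLocalOn_stableExt (hm : m ≤ m0) (hf : IsLocalOn m D f) :
    IsLocalOn m (hull m D) (stableExt m D f) := by
  intro x hx y hy S hS h
  obtain ⟨A, ys, hA, hys, hy, hfy⟩ := stableExt_spec (f := f) hm hy
  refine hA.ae_restrict_of_forall fun k => ?_
  have hxy : x =ᵐ[μ.restrict (S ∩ A k)] ys k :=
    (eq_on_mono inter_subset_left h).trans
      (eq_on_mono inter_subset_right (hy k))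
  exact (stableExt_eq_on hm hf hx (hys k) (hS.inter (hA.1 k)) hxy).trans
    (eq_on_mono inter_subset_right (hfy k)).symm

end Hull

section Module

variable {Ω : Type*} {m m0 : MeasurableSpace Ω} {μ : Measure[m0] Ω} [IsFiniteMeasure μ]
  {φ : ℝ≥0 → ℝ≥0∞} {x l : Ω →ₘ[μ] ℝ}

theorem glue_zero_mem_orlicz (hm : m ≤ m0) (hφ : Monotone φ) (hφ0 : φ 0 = 0) {A : Set Ω}
    (hA : MeasurableSet[m] A) {C : ℝ≥0} (hC : 0 < C)
    (hl : ∀ᵐ ω ∂μ.restrict A, 0 < l ω ∧ l ω ≤ C)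
    (hx : ∀ᵐ ω ∂μ.restrict A, condLExp m μ (fun ω => φ (‖x ω‖₊ / ‖l ω‖₊)) ω ≤ C) :
    glue (hm _ hA) x 0 ∈ orlicz m0 μ φ := by
  refine ⟨mem_L0_top _, C, hC, ?_⟩
  have hoff : ∫⁻ ω in Aᶜ, φ (‖glue (hm _ hA) x 0 ω‖₊ / C) ∂μ = 0 := by
    rw [← lintegral_zero (μ := μ.restrict Aᶜ)]
    refine lintegral_congr_ae ?_
    filter_upwards [glue_eq_on_compl (hm _ hA) x 0,
      (AEEqFun.coeFn_zero (β := ℝ) (μ := μ)).restrict] with ω h h0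
    rw [h, h0, Pi.zero_apply, nnnorm_zero, zero_div, hφ0]
  rw [← lintegral_add_compl _ (hm _ hA), hoff, add_zero]
  calc ∫⁻ ω in A, φ (‖glue (hm _ hA) x 0 ω‖₊ / C) ∂μ
      ≤ ∫⁻ ω in A, φ (‖x ω‖₊ / ‖l ω‖₊) ∂μ := by
        refine lintegral_mono_ae ?_
        filter_upwards [glue_eq_on (hm _ hA) x 0, hl] with ω h hl
        have hlC : ‖l ω‖₊ ≤ C := by
          rw [← NNReal.coe_le_coe, coe_nnnorm, Real.norm_of_nonneg hl.1.le]
          exact hl.2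
        rw [h]
        exact hφ (div_le_div_of_nonneg_left zero_le (nnnorm_pos.2 hl.1.ne') hlC)
    _ = ∫⁻ ω in A, condLExp m μ (fun ω => φ (‖x ω‖₊ / ‖l ω‖₊)) ω ∂μ :=
        (setLIntegral_condLExp hm _ _ hA).symm
    _ ≤ ∫⁻ _ in A, C ∂μ := lintegral_mono_ae hx
    _ < ∞ := by
        rw [setLIntegral_const]
        exact ENNReal.mul_lt_top ENNReal.coe_lt_top (measure_lt_top _ _)

theorem mem_hull_of_mem_orliczModule (hm : m ≤ m0) (hφ : Monotone φ) (hφ0 : φ 0 = 0)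
    (hx : x ∈ orliczModule m μ φ) : x ∈ hull m (orlicz m0 μ φ) := by
  obtain ⟨l, ⟨⟨f, hf, hlf⟩, hl0⟩, hfin⟩ := hx
  set g := condLExp m μ (fun ω => φ (‖x ω‖₊ / ‖l ω‖₊))
  let N : Ω → ℕ := fun ω => ⌈max (f ω) (g ω).toReal⌉₊
  have hN : Measurable[m] N := Nat.measurable_ceil.comp
    (measurable_sup.comp (hf.measurable.prodMk
      (ENNReal.measurable_toReal.comp (measurable_condLExp _ _ _))))
  have hA := isPartition_preimage_singleton hN
  refine ⟨_, fun k => glue (hm _ (hA.1 k)) x 0, hA, fun k => ?_, fun k =>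
    (glue_eq_on (hm _ (hA.1 k)) x 0).symm⟩
  have hbound {ω : Ω} (hω : N ω = k) : f ω ≤ k ∧ (g ω).toReal ≤ k := by
    rw [← hω]
    exact max_le_iff.1 (Nat.le_ceil _)
  refine glue_zero_mem_orlicz (l := l) (C := k + 1) hm hφ hφ0 (hA.1 k) (by positivity) ?_ ?_
  · filter_upwards [hlf.restrict, ae_restrict_of_ae hl0, ae_restrict_mem (hm _ (hA.1 k))]
      with ω h h0 hω
    refine ⟨h0, ?_⟩
    rw [h, NNReal.coe_add, NNReal.coe_natCast]
    exact (hbound hω).1.trans (le_add_of_nonneg_right zero_le_one)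
  · filter_upwards [ae_restrict_of_ae hfin, ae_restrict_mem (hm _ (hA.1 k))] with ω h hω
    refine (ENNReal.toReal_le_toReal h.ne ENNReal.coe_ne_top).1 ((hbound hω).2.trans ?_)
    rw [ENNReal.coe_toReal, NNReal.coe_add, NNReal.coe_natCast]
    exact le_add_of_nonneg_right zero_le_one

theorem mem_orliczModule_of_mem_hull (hm : m ≤ m0) (hx : x ∈ hull m (orlicz m0 μ φ)) :
    x ∈ orliczModule m μ φ := by
  obtain ⟨A, xs, hA, hxs, hx⟩ := hx
  choose _ c hc hxc using hxs
  obtain ⟨f, hf, h⟩ := hA.exists_measurable_eqOn (g := fun k _ => (c k : ℝ))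
    fun k => @measurable_const _ _ _ m _
  obtain ⟨l, hl, hlf⟩ := exists_mem_L0_ae_eq (μ := μ) hm (Measurable.stronglyMeasurable hf)
  have hlc k : ∀ᵐ ω ∂μ.restrict (A k), l ω = c k :=
    hlf.restrict.trans ((h k).aeEq_restrict (hm _ (hA.1 k)))
  refine ⟨l, ⟨hl, hA.ae_of_forall fun k => (hlc k).mono fun ω h => h ▸ hc k⟩,
    hA.ae_of_forall fun k => ae_lt_top' (measurable_condLExp' _ _ _).aemeasurable ?_⟩
  rw [setLIntegral_condLExp hm _ _ (hA.1 k)]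
  refine ne_top_of_le_ne_top (hxc k).ne
    (le_trans (lintegral_mono_ae ?_) (setLIntegral_le_lintegral (A k) _))
  filter_upwards [hx k, hlc k] with ω h1 h2
  rw [h1, h2, NNReal.nnnorm_eq]

theorem orliczModule_eq_hull (hm : m ≤ m0) (hφ : Monotone φ) (hφ0 : φ 0 = 0) :
    orliczModule m μ φ = hull m (orlicz m0 μ φ) :=
  Subset.antisymm (fun _ => mem_hull_of_mem_orliczModule hm hφ hφ0)
    fun _ => mem_orliczModule_of_mem_hull hm

end Module

section CondE

variable {Ω : Type*} {m m0 : MeasurableSpace Ω} {μ : Measure[m0] Ω} {x y l : Ω →ₘ[μ] ℝ}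

theorem integrable_sub_class (hx : Integrable x μ) (hy : Integrable y μ) :
    Integrable ↑(x - y) μ :=
  (hx.sub hy).congr (AEEqFun.coeFn_sub x y).symm

theorem integrable_add_class (hx : Integrable x μ) (hy : Integrable y μ) :
    Integrable ↑(x + y) μ :=
  (hx.add hy).congr (AEEqFun.coeFn_add x y).symm

theorem coeFn_condE (x : Ω →ₘ[μ] ℝ) : condE m μ x =ᵐ[μ] μ[x | m] := AEEqFun.coeFn_mk _ _

theorem condE_add (hx : Integrable x μ) (hy : Integrable y μ) :
    condE m μ (x + y) = condE m μ x + condE m μ y := by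
  refine AEEqFun.ext ((coeFn_condE _).trans (((condExp_congr_ae (AEEqFun.coeFn_add x y)).trans
    (condExp_add hx hy m)).trans ?_))
  exact ((coeFn_condE x).symm.add (coeFn_condE y).symm).trans (AEEqFun.coeFn_add _ _).symm

theorem condE_sub (hx : Integrable x μ) (hy : Integrable y μ) :
    condE m μ (x - y) = condE m μ x - condE m μ y := by
  refine AEEqFun.ext ((coeFn_condE _).trans (((condExp_congr_ae (AEEqFun.coeFn_sub x y)).trans
    (condExp_sub hx hy m)).trans ?_))
  exact ((coeFn_condE x).symm.sub (coeFn_condE y).symm).trans (AEEqFun.coeFn_sub _ _).symm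

theorem condE_zero : condE m μ (0 : Ω →ₘ[μ] ℝ) = 0 := by
  have h0 : Integrable (0 : Ω →ₘ[μ] ℝ) μ :=
    (integrable_zero Ω ℝ μ).congr AEEqFun.coeFn_zero.symm
  simpa only [sub_self] using condE_sub (m := m) h0 h0

theorem condE_neg (x : Ω →ₘ[μ] ℝ) : condE m μ (-x) = -condE m μ x := by
  refine AEEqFun.ext ((coeFn_condE _).trans (((condExp_congr_ae (AEEqFun.coeFn_neg x)).trans
    (condExp_neg x m)).trans ?_))
  exact (coeFn_condE x).symm.neg.trans (AEEqFun.coeFn_neg _).symm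

theorem condE_mul_of_mem_L0 (hl : l ∈ L0 m μ) (hx : Integrable x μ) (hlx : Integrable ↑(l * x) μ) :
    condE m μ (l * x) = l * condE m μ x := by
  have hmul := AEEqFun.coeFn_mul l x
  refine AEEqFun.ext ((coeFn_condE _).trans (((condExp_congr_ae hmul).trans
    (condExp_mul_of_aestronglyMeasurable_left hl (hlx.congr hmul) hx)).trans ?_))
  exact ((ae_eq_refl ⇑l).mul (coeFn_condE x).symm).trans (AEEqFun.coeFn_mul _ _).symm

theorem integrable_mul_of_bounded (C : ℝ≥0) (hl : ∀ᵐ ω ∂μ, |l ω| ≤ C) (hx : Integrable x μ) :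
    Integrable ↑(l * x) μ :=
  (hx.bdd_mul l.aestronglyMeasurable hl).congr (AEEqFun.coeFn_mul l x).symm

theorem condE_mul_of_bounded (hl : l ∈ L0 m μ) (C : ℝ≥0) (hlC : ∀ᵐ ω ∂μ, |l ω| ≤ C)
    (hx : Integrable x μ) : condE m μ (l * x) = l * condE m μ x :=
  condE_mul_of_mem_L0 hl hx (integrable_mul_of_bounded C hlC hx)

theorem condE_convexComb (hl : l ∈ L0 m μ) (hl0 : 0 ≤ l) (hl1 : l ≤ 1) (hx : Integrable x μ)
    (hy : Integrable y μ) :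
    condE m μ (l * x + (1 - l) * y) = l * condE m μ x + (1 - l) * condE m μ y := by
  have hl_abs : ∀ᵐ ω ∂μ, |l ω| ≤ (1 : ℝ≥0) := by
    filter_upwards [zero_le_iff_ae.1 hl0, le_one_iff_ae.1 hl1] with ω h0 h1
    rwa [abs_of_nonneg h0]
  have hxy := integrable_sub_class hx hy
  rw [show l * x + (1 - l) * y = y + l * (x - y) by ring,
    condE_add hy (integrable_mul_of_bounded 1 hl_abs hxy), condE_mul_of_bounded hl 1 hl_abs hxy,
    condE_sub hx hy]
  ring

theorem condE_glue {A : Set Ω} (hA : MeasurableSet[m] A) (hA' : MeasurableSet A)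
    (hx : Integrable x μ) (hy : Integrable y μ) :
    condE m μ (glue hA' x y) = glue hA' (condE m μ x) (condE m μ y) :=
  condE_convexComb (ind_mem_L0 hA hA') (ind_nonneg hA') (ind_le_one hA') hx hy

theorem coeFn_condE_sum {ι : Type*} (s : Finset ι) {x : ι → (Ω →ₘ[μ] ℝ)}
    (hx : ∀ i ∈ s, Integrable (x i) μ) :
    ∀ᵐ ω ∂μ, condE m μ (∑ i ∈ s, x i) ω = ∑ i ∈ s, condE m μ (x i) ω := by
  have hsum : ⇑(∑ i ∈ s, x i) =ᵐ[μ] ∑ i ∈ s, ⇑(x i) :=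
    (AEEqFun.coeFn_fun_finsetSum s x).mono fun ω h => h.trans (Finset.sum_apply ω s _).symm
  have hcoe : ∀ᵐ ω ∂μ, ∀ i ∈ s, condE m μ (x i) ω = (μ[x i | m]) ω :=
    (ae_ball_iff s.countable_toSet).2 fun i _ => coeFn_condE (x i)
  filter_upwards [coeFn_condE (m := m) (∑ i ∈ s, x i), condExp_congr_ae (m := m) hsum,
    condExp_finsetSum hx m, hcoe] with ω h1 h2 h3 h
  rw [h1, h2, h3, Finset.sum_apply, Finset.sum_congr rfl h]

theorem condE_of_mem_L0 [IsFiniteMeasure μ] (hm : m ≤ m0) (hl : l ∈ L0 m μ)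
    (hint : Integrable l μ) : condE m μ l = l :=
  AEEqFun.ext ((coeFn_condE l).trans (condExp_of_aestronglyMeasurable' hm hl hint))

theorem isLocalOn_condE : IsLocalOn m {z : Ω →ₘ[μ] ℝ | Integrable z μ} (condE m μ) := by
  intro x hx y hy A hA h
  have hzero : μ[⇑(x - y) | m] =ᵐ[μ.restrict A] 0 := condExp_ae_eq_restrict_zero hA <| by
    filter_upwards [(AEEqFun.coeFn_sub x y).restrict, h] with ω hsub hω
    rw [hsub, Pi.sub_apply, hω, sub_self, Pi.zero_apply]
  have hsub := condE_sub (m := m) hx hy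
  filter_upwards [hzero, (coeFn_condE (m := m) (x - y)).restrict,
    (AEEqFun.coeFn_sub (condE m μ x) (condE m μ y)).restrict] with ω h0 h1 h2
  rw [← hsub, h1, h0, Pi.zero_apply, Pi.sub_apply] at h2
  exact (sub_eq_zero.1 h2.symm)

theorem condEExt_eq (hm : m ≤ m0) (hx : Integrable x μ) : condEExt m μ x = condE m μ x :=
  stableExt_eq hm isLocalOn_condE hx

theorem condEExt_eq_on (hm : m ≤ m0) (hx : x ∈ hull m {z : Ω →ₘ[μ] ℝ | Integrable z μ})
    (hy : Integrable y μ) {A : Set Ω} (hA : MeasurableSet[m] A) (h : x =ᵐ[μ.restrict A] y) :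
    condEExt m μ x =ᵐ[μ.restrict A] condE m μ y :=
  stableExt_eq_on hm isLocalOn_condE hx hy hA h

theorem condEExt_sub (hm : m ≤ m0) (hx : x ∈ hull m {z : Ω →ₘ[μ] ℝ | Integrable z μ})
    (hy : y ∈ hull m {z : Ω →ₘ[μ] ℝ | Integrable z μ}) :
    condEExt m μ (x - y) = condEExt m μ x - condEExt m μ y := by
  have hxy : x - y ∈ hull m {z : Ω →ₘ[μ] ℝ | Integrable z μ} :=
    sub_mem_hull (fun x hx y hy => integrable_sub_class hx hy) hx hy
  obtain ⟨A, xs, ys, hA, hxs, hys⟩ := exists_common_partition hx hy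
  refine AEEqFun.ext (hA.ae_of_forall fun k => ?_)
  have h := condEExt_eq_on hm hxy (integrable_sub_class (hxs k).1 (hys k).1) (hA.1 k)
    (sub_congr_on (hxs k).2 (hys k).2)
  rw [condE_sub (hxs k).1 (hys k).1] at h
  exact h.trans (sub_congr_on (condEExt_eq_on hm hx (hxs k).1 (hA.1 k) (hxs k).2)
    (condEExt_eq_on hm hy (hys k).1 (hA.1 k) (hys k).2)).symm

end CondE

section Locality

variable {Ω : Type*} {m m0 : MeasurableSpace Ω} {μ : Measure[m0] Ω} {φ ψ : ℝ≥0 → ℝ≥0∞}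
  {ρ : (Ω →ₘ[μ] ℝ) → (Ω →ₘ[μ] ℝ)} {x y : Ω →ₘ[μ] ℝ}

theorem IsCondConvexRiskMeasure.mem_L0 (hρ : IsCondConvexRiskMeasure m μ φ ψ ρ)
    (hx : x ∈ orlicz m0 μ φ) : ρ x ∈ L0 m μ := (hρ.mapsTo hx).1

theorem IsCondConvexRiskMeasure.le_on_of_eq_on (hm : m ≤ m0)
    (hρ : IsCondConvexRiskMeasure m μ φ ψ ρ) (hx : x ∈ orlicz m0 μ φ) (hy : y ∈ orlicz m0 μ φ)
    {A : Set Ω} (hA : MeasurableSet[m] A) (h : x =ᵐ[μ.restrict A] y) :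
    ρ x ≤ᵐ[μ.restrict A] ρ y := by
  have hA' := hm _ hA
  have hx_glue : x = glue hA' y x := (glue_eq_right hA' h.symm).symm
  have hconv : ρ x ≤ glue hA' (ρ y) (ρ x) := by
    conv_lhs => rw [hx_glue]
    exact hρ.convex y hy x hx _ (ind_mem_L0 hA hA') (ind_nonneg hA') (ind_le_one hA')
  exact EventuallyLE.trans_eq (ae_restrict_of_ae (AEEqFun.coeFn_le.2 hconv))
    (glue_eq_on hA' _ _)

theorem IsCondConvexRiskMeasure.isLocalOn (hm : m ≤ m0)
    (hρ : IsCondConvexRiskMeasure m μ φ ψ ρ) : IsLocalOn m (orlicz m0 μ φ) ρ :=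
  fun _ hx _ hy _ hA h => (hρ.le_on_of_eq_on hm hx hy hA h).antisymm
    (hρ.le_on_of_eq_on hm hy hx hA h.symm)

end Locality

section Separation

variable {E : Type*} [NormedAddCommGroup E] [InnerProductSpace ℝ E]

theorem cauchySeq_of_midpoint_norm_ge {u : ℕ → E} {d : ℝ} (hd : 0 ≤ d)
    (hu : Tendsto (fun n => ‖u n‖) atTop (𝓝 d))
    (hmid : ∀ n k, d ≤ ‖(1 / 2 : ℝ) • u n + (1 - 1 / 2 : ℝ) • u k‖) : CauchySeq u := by
  refine Metric.cauchySeq_iff.2 fun e he => ?_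
  have hlt : d ^ 2 < d ^ 2 + e ^ 2 / 8 := lt_add_of_pos_right _ (by positivity)
  obtain ⟨N, hN⟩ := ((hu.pow 2).eventually (gt_mem_nhds hlt)).exists_forall_of_atTop
  refine ⟨N, fun n hn k hk => ?_⟩
  have hsum : 2 * d ≤ ‖u n + u k‖ := by
    have h := hmid n k
    rw [show (1 - 1 / 2 : ℝ) = 1 / 2 by norm_num, ← smul_add, norm_smul,
      Real.norm_of_nonneg (by norm_num)] at h
    linarith
  have hsum_sq : (2 * d) ^ 2 ≤ ‖u n + u k‖ ^ 2 := by gcongr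
  have hpar := parallelogram_law_with_norm ℝ (u n) (u k)
  rw [dist_eq_norm]
  refine lt_of_pow_lt_pow_left₀ 2 he.le ?_
  nlinarith [hN n hn, hN k hk]

theorem norm_sq_le_inner_of_segment {v f : E}
    (hseg : ∀ k : ℕ, ‖v‖ ≤ ‖(1 / (k + 1) : ℝ) • f + (1 - 1 / (k + 1) : ℝ) • v‖) :
    ‖v‖ ^ 2 ≤ inner ℝ v f := by
  have hderiv (k : ℕ) : 0 ≤ 2 * (inner ℝ v f - ‖v‖ ^ 2) + 1 / (k + 1 : ℝ) * ‖f - v‖ ^ 2 := by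
    set t : ℝ := 1 / (k + 1 : ℝ)
    have ht0 : 0 < t := by positivity
    have hsq : ‖v‖ ^ 2 ≤ ‖v + t • (f - v)‖ ^ 2 := by
      have h := hseg k
      rw [show t • f + (1 - t) • v = v + t • (f - v) by module] at h
      gcongr
    rw [norm_add_sq_real, inner_smul_right, inner_sub_right, real_inner_self_eq_norm_sq,
      norm_smul, Real.norm_of_nonneg ht0.le, mul_pow] at hsq
    exact nonneg_of_mul_nonneg_right (by linarith : 0 ≤ t * _) ht0
  have hlim : Tendsto
      (fun k : ℕ => 2 * (inner ℝ v f - ‖v‖ ^ 2) + 1 / (k + 1 : ℝ) * ‖f - v‖ ^ 2)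
      atTop (𝓝 (2 * (inner ℝ v f - ‖v‖ ^ 2) + 0 * ‖f - v‖ ^ 2)) :=
    (tendsto_one_div_add_atTop_nhds_zero_nat.mul_const _).const_add _
  linarith [ge_of_tendsto' hlim hderiv]

variable {Ω ι : Type*} {m m0 : MeasurableSpace Ω} {μ : Measure[m0] Ω} {f : ι → Ω → E}

variable (m μ) in
/-- Conditional convexity of a family of random vectors: it is closed, up to null sets, under
convex combinations with random weights from `L⁰(𝓕)`. -/
def IsCondConvexFamily (f : ι → Ω → E) : Prop :=
  ∀ i j, ∀ l ∈ L0 m μ, 0 ≤ l → l ≤ 1 →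
    ∃ k, ∀ᵐ ω ∂μ, f k ω = l ω • f i ω + (1 - l ω) • f j ω

theorem IsCondConvexFamily.exists_const_combination (hf : IsCondConvexFamily m μ f) (i j : ι)
    {t : ℝ} (h0 : 0 ≤ t) (h1 : t ≤ 1) :
    ∃ k, ∀ᵐ ω ∂μ, f k ω = t • f i ω + (1 - t) • f j ω := by
  have hcoe : AEEqFun.const (μ := μ) Ω t =ᵐ[μ] fun _ => t := AEEqFun.coeFn_const Ω t
  obtain ⟨k, hk⟩ := hf i j (AEEqFun.const Ω t)
    (mem_L0_of_ae_eq (@stronglyMeasurable_const _ _ m _ t) hcoe)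
    (zero_le_iff_ae.2 (hcoe.mono fun ω h => h0.trans_eq h.symm))
    (le_one_iff_ae.2 (hcoe.mono fun ω h => h.trans_le h1))
  refine ⟨k, ?_⟩
  filter_upwards [hk, hcoe] with ω hω ht
  rw [hω, ht]

theorem IsCondConvexFamily.exists_norm_le (hm : m ≤ m0) (hf : IsCondConvexFamily m μ f)
    (hmeas : ∀ i, StronglyMeasurable[m] (f i)) (i j : ι) :
    ∃ k, ∀ᵐ ω ∂μ, ‖f k ω‖ ≤ ‖f i ω‖ ∧ ‖f k ω‖ ≤ ‖f j ω‖ := by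
  have hA : MeasurableSet[m] {ω | ‖f i ω‖ ≤ ‖f j ω‖} :=
    StronglyMeasurable.measurableSet_le (hmeas i).norm (hmeas j).norm
  have hA' := hm _ hA
  obtain ⟨k, hk⟩ := hf i j (ind μ hA') (ind_mem_L0 hA hA') (ind_nonneg hA') (ind_le_one hA')
  refine ⟨k, ?_⟩
  filter_upwards [hk, coeFn_ind hA'] with ω hω hind
  rw [hω, hind]
  by_cases hle : ‖f i ω‖ ≤ ‖f j ω‖
  · simpa [indicator_of_mem (show ω ∈ {ω | ‖f i ω‖ ≤ ‖f j ω‖} from hle)] using hle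
  · simpa [indicator_of_notMem (show ω ∉ {ω | ‖f i ω‖ ≤ ‖f j ω‖} from hle)] using
      (not_le.1 hle).le

theorem IsCondConvexFamily.exists_minimizing_seq [IsFiniteMeasure μ] [Nonempty ι] (hm : m ≤ m0)
    (hf : IsCondConvexFamily m μ f) (hmeas : ∀ i, StronglyMeasurable[m] (f i)) :
    ∃ u : ℕ → ι, ∃ d : Ω → ℝ, (∀ ω, d ω = ⨅ n, ‖f (u n) ω‖) ∧
      (∀ᵐ ω ∂μ, Tendsto (fun n => ‖f (u n) ω‖) atTop (𝓝 (d ω))) ∧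
        ∀ i, ∀ᵐ ω ∂μ, d ω ≤ ‖f i ω‖ := by
  obtain ⟨s, hs⟩ := exists_seq_forall_ae_forall_gt_exists_gt (μ := μ)
    fun i => ((hmeas i).mono hm).norm.measurable
  choose M hM using hf.exists_norm_le hm hmeas
  let u : ℕ → ι := fun n => Nat.rec (s 0) (fun n i => M i (s (n + 1))) n
  have hanti : ∀ᵐ ω ∂μ, Antitone fun n => ‖f (u n) ω‖ :=
    (ae_all_iff.2 fun n => (hM (u n) (s (n + 1))).mono fun ω h => h.1).mono
      fun ω h => antitone_nat_of_succ_le h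
  have hus : ∀ n, ∀ᵐ ω ∂μ, ‖f (u n) ω‖ ≤ ‖f (s n) ω‖ := fun n => by
    cases n with
    | zero => exact ae_of_all _ fun ω => le_rfl
    | succ n => exact (hM (u n) (s (n + 1))).mono fun ω h => h.2
  have hbdd (ω : Ω) : BddBelow (range fun n => ‖f (u n) ω‖) :=
    ⟨0, forall_mem_range.2 fun n => norm_nonneg _⟩
  refine ⟨u, _, fun ω => rfl, ?_, fun i => ?_⟩
  · filter_upwards [hanti] with ω h using tendsto_atTop_ciInf h (hbdd ω)
  · filter_upwards [hs i, ae_all_iff.2 hus] with ω hi hu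
    by_contra! hlt
    obtain ⟨n, hn⟩ := hi _ hlt
    exact ((ciInf_le (hbdd ω) n).trans (hu n)).not_gt hn

theorem IsCondConvexFamily.exists_inner_pos [IsFiniteMeasure μ] [Nonempty ι] [CompleteSpace E]
    (hm : m ≤ m0) (hf : IsCondConvexFamily m μ f) (hmeas : ∀ i, StronglyMeasurable[m] (f i))
    {D : Set Ω} {e : Ω → ℝ} (he : ∀ᵐ ω ∂μ.restrict D, 0 < e ω)
    (hef : ∀ i, ∀ᵐ ω ∂μ.restrict D, e ω ≤ ‖f i ω‖) :
    ∃ v : Ω → E, StronglyMeasurable[m] v ∧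
      ∀ i, ∀ᵐ ω ∂μ.restrict D, 0 < inner ℝ (v ω) (f i ω) := by
  obtain ⟨u, d, hd, hlim, hdle⟩ := hf.exists_minimizing_seq hm hmeas
  have hcomb (i j : ι) {t : ℝ} (h0 : 0 ≤ t) (h1 : t ≤ 1) :
      ∀ᵐ ω ∂μ, d ω ≤ ‖t • f i ω + (1 - t) • f j ω‖ := by
    obtain ⟨k, hk⟩ := hf.exists_const_combination i j h0 h1
    filter_upwards [hk, hdle k] with ω hω h
    rwa [hω] at h
  have hcauchy : ∀ᵐ ω ∂μ, CauchySeq fun n => f (u n) ω := by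
    have hmid : ∀ᵐ ω ∂μ, ∀ n k,
        d ω ≤ ‖(1 / 2 : ℝ) • f (u n) ω + (1 - 1 / 2 : ℝ) • f (u k) ω‖ :=
      ae_all_iff.2 fun n => ae_all_iff.2 fun k => hcomb _ _ (by norm_num) (by norm_num)
    filter_upwards [hlim, hmid] with ω h hmid
    exact cauchySeq_of_midpoint_norm_ge (ge_of_tendsto' h fun n => norm_nonneg _) h hmid
  refine ⟨fun ω => limUnder atTop fun n => f (u n) ω,
    @StronglyMeasurable.limUnder _ _ _ m _ _ _ _ _ _ _ fun n => hmeas _, fun i => ?_⟩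
  have hseg : ∀ᵐ ω ∂μ, ∀ k n : ℕ,
      d ω ≤ ‖(1 / (k + 1) : ℝ) • f i ω + (1 - 1 / (k + 1) : ℝ) • f (u n) ω‖ :=
    ae_all_iff.2 fun k => ae_all_iff.2 fun n => hcomb _ _ (by positivity)
      ((div_le_one (by positivity)).2 (le_add_of_nonneg_left k.cast_nonneg))
  filter_upwards [ae_restrict_of_ae hlim, ae_restrict_of_ae hcauchy, ae_restrict_of_ae hseg, he,
    ae_all_iff.2 fun n => hef (u n)] with ω hω hC hseg he0 hele
  have hv := hC.tendsto_limUnder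
  have hvd := tendsto_nhds_unique hv.norm hω
  have hpos : 0 < d ω := he0.trans_le (hd ω ▸ le_ciInf hele)
  refine (pow_pos hpos 2).trans_le ?_
  rw [← hvd]
  refine norm_sq_le_inner_of_segment fun k => ?_
  rw [hvd]
  exact ge_of_tendsto' ((hv.const_smul _).const_add _).norm fun n => hseg k n

end Separation

section Neighbourhood

variable {Ω : Type*} {m m0 : MeasurableSpace Ω} {μ : Measure[m0] Ω} {φ ψ : ℝ≥0 → ℝ≥0∞}
  {ρ : (Ω →ₘ[μ] ℝ) → (Ω →ₘ[μ] ℝ)}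

theorem weakLSC_iff {E G : Set (Ω →ₘ[μ] ℝ)} {f : (Ω →ₘ[μ] ℝ) → (Ω →ₘ[μ] ℝ)} :
    WeakLSC m μ E G f ↔ ∀ c ∈ L0 m μ, ∀ x ∈ E, ¬ f x ≤ c →
      ∃ Q : Finset (Ω →ₘ[μ] ℝ), ↑Q ⊆ G ∧ ∃ e ∈ L0pp m μ, ∀ z ∈ E,
        (∀ q ∈ Q, ∀ᵐ ω ∂μ, |condEExt m μ ((z - x) * q) ω| ≤ e ω) → ¬ f z ≤ c := by
  refine forall₂_congr fun c _ => ?_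
  rw [← @isOpen_compl_iff]
  exact ⟨fun h x hx hxc => (h ⟨x, hx⟩ hxc).imp fun Q hQ =>
      ⟨hQ.1, hQ.2.imp fun e he => ⟨he.1, fun z hz => he.2 ⟨z, hz⟩⟩⟩,
    fun h x hxc => (h x x.2 hxc).imp fun Q hQ =>
      ⟨hQ.1, hQ.2.imp fun e he => ⟨he.1, fun z => he.2 z z.2⟩⟩⟩

theorem exists_mem_hull_eq_on_cover (hm : m ≤ m0) {D : Set (Ω →ₘ[μ] ℝ)} {A : ℕ → Set Ω}
    (hA : ∀ n, MeasurableSet[m] (A n)) (hAU : μ (⋃ n, A n)ᶜ = 0) {xs : ℕ → (Ω →ₘ[μ] ℝ)}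
    (hxs : ∀ n, xs n ∈ D) :
    ∃ u ∈ hull m D, ∃ P : ℕ → Set Ω, IsPartition m P ∧
      (∀ n, u =ᵐ[μ.restrict (P n)] xs n) ∧ ∀ n, ∀ᵐ ω ∂μ.restrict (P n), ω ∈ A n := by
  let C : ℕ → Set Ω := fun n => A n ∪ (⋃ n, A n)ᶜ
  have hP : IsPartition m (disjointed C) :=
    isPartition_disjointed (fun n => (hA n).union (MeasurableSet.iUnion hA).compl) <| by
      rw [← iUnion_union, union_compl_self]
  obtain ⟨u, hu⟩ := exists_eq_on_partition ⟨fun n => hm _ (hP.1 n), hP.2⟩ xs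
  refine ⟨u, ⟨_, xs, hP, hxs, hu⟩, _, hP, hu, fun n => ?_⟩
  filter_upwards [ae_restrict_mem (hm _ (hP.1 n)),
    ae_restrict_of_ae (measure_eq_zero_iff_ae_notMem.1 hAU)] with ω hω h
  exact (disjointed_subset C n hω).resolve_right h

theorem exists_subset_finset_of_subset_hull {D : Set (Ω →ₘ[μ] ℝ)} (Q : Finset (Ω →ₘ[μ] ℝ))
    (hQ : ↑Q ⊆ hull m D) {B : Set Ω} (hBm : MeasurableSet[m] B) (hB : μ B ≠ 0) :
    ∃ A ⊆ B, MeasurableSet[m] A ∧ μ A ≠ 0 ∧ ∃ R : Finset (Ω →ₘ[μ] ℝ), ↑R ⊆ D ∧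
      ∀ q ∈ Q, ∃ r ∈ R, q =ᵐ[μ.restrict A] r := by
  classical
  induction Q using Finset.induction_on with
  | empty => exact ⟨B, subset_rfl, hBm, hB, ∅, by simp⟩
  | insert a s ha ih =>
    obtain ⟨A, hAB, hAm, hA, R, hRD, hR⟩ :=
      ih ((Finset.coe_subset.2 (Finset.subset_insert a s)).trans hQ)
    obtain ⟨A', hA'A, hA'm, hA', r, hr, har⟩ :=
      exists_subset_eq_of_mem_hull (hQ (Finset.mem_insert_self a s)) hAm hA
    refine ⟨A', hA'A.trans hAB, hA'm, hA', insert r R, ?_, fun q hq => ?_⟩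
    · rw [Finset.coe_insert]
      exact insert_subset hr hRD
    · obtain rfl | hq := Finset.mem_insert.1 hq
      · exact ⟨r, Finset.mem_insert_self r R, har⟩
      · obtain ⟨r', hr', h⟩ := hR q hq
        exact ⟨r', Finset.mem_insert_of_mem hr', eq_on_mono hA'A h⟩

variable {Q : Finset (Ω →ₘ[μ] ℝ)} {A : Set Ω} {c e u x z : Ω →ₘ[μ] ℝ}

variable (m) in
/-- On the set `A`, the element `z` lies in the weak neighbourhood of `x` given by `Q` and `e`. -/
def IsNearOn (Q : Finset (Ω →ₘ[μ] ℝ)) (e x z : Ω →ₘ[μ] ℝ) (A : Set Ω) : Prop :=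
  ∀ q ∈ Q, ∀ᵐ ω ∂μ.restrict A, |condEExt m μ ((z - x) * q) ω| ≤ e ω

variable (μ) in
/-- The elements of `L^φ(𝓔)` which belong to the sublevel set `{ρ ≤ c}` on `D`. -/
def sublevelOn (φ : ℝ≥0 → ℝ≥0∞) (ρ : (Ω →ₘ[μ] ℝ) → (Ω →ₘ[μ] ℝ)) (c : Ω →ₘ[μ] ℝ) (D : Set Ω) :
    Set (Ω →ₘ[μ] ℝ) :=
  {z | z ∈ orlicz m0 μ φ ∧ ∀ᵐ ω ∂μ.restrict D, ρ z ω ≤ c ω}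

theorem sub_mul_mem_hull_integrable (hφ : Monotone φ) (hz : z ∈ hull m (orlicz m0 μ φ))
    (hx : x ∈ hull m (orlicz m0 μ φ)) (hu : u ∈ hull m (orlicz m0 μ (conj φ))) :
    (z - x) * u ∈ hull m {w : Ω →ₘ[μ] ℝ | Integrable w μ} :=
  mul_mem_hull (fun _ hx _ hy => integrable_mul_of_mem_orlicz hφ hx hy)
    (sub_mem_hull (fun _ hx _ hy => sub_mem_orlicz hφ hx hy) hz hx) hu

theorem IsNearOn.congr (hm : m ≤ m0) (hφ : Monotone φ) (hQ : ↑Q ⊆ hull m (orlicz m0 μ (conj φ)))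
    (hx : x ∈ hull m (orlicz m0 μ φ)) (hz : z ∈ hull m (orlicz m0 μ φ))
    (hu : u ∈ hull m (orlicz m0 μ φ)) (hA : MeasurableSet[m] A) (h : u =ᵐ[μ.restrict A] z)
    (hnear : IsNearOn m Q e x z A) : IsNearOn m Q e x u A := by
  intro q hq
  have hpair := isLocalOn_stableExt hm isLocalOn_condE _
    (sub_mul_mem_hull_integrable hφ hu hx (hQ hq)) _
    (sub_mul_mem_hull_integrable hφ hz hx (hQ hq)) A hA
    (mul_congr_on (sub_congr_on h (ae_eq_refl ⇑x)) (ae_eq_refl ⇑q))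
  filter_upwards [hpair, hnear q hq] with ω h1 h2
  exact h1 ▸ h2

theorem isNearOn_self (hm : m ≤ m0) (hφ : Monotone φ) (hQ : ↑Q ⊆ hull m (orlicz m0 μ (conj φ)))
    (he : e ∈ L0pp m μ) (hx : x ∈ hull m (orlicz m0 μ φ)) : IsNearOn m Q e x x A := by
  intro q hq
  have hmem := sub_mul_mem_hull_integrable hφ hx hx (hQ hq)
  have hzero : condEExt m μ ((x - x) * q) = 0 := by
    have h := condEExt_sub hm hmem hmem
    rw [sub_self, sub_self] at h
    rwa [show (x - x) * q = 0 by ring]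
  filter_upwards [ae_restrict_of_ae he.2,
    ae_restrict_of_ae (AEEqFun.coeFn_zero (β := ℝ) (μ := μ))] with ω he0 h0
  rw [hzero, h0, Pi.zero_apply, abs_zero]
  exact he0.le

theorem exists_near_mem_sublevel_of_cover (hm : m ≤ m0) (hφ : Monotone φ)
    (hρ : IsCondConvexRiskMeasure m μ φ ψ ρ) (hQ : ↑Q ⊆ hull m (orlicz m0 μ (conj φ)))
    (hx : x ∈ hull m (orlicz m0 μ φ)) {A : ℕ → Set Ω} (hA : ∀ n, MeasurableSet[m] (A n))
    (hAU : μ (⋃ n, A n)ᶜ = 0) {zs : ℕ → (Ω →ₘ[μ] ℝ)} (hzs : ∀ n, zs n ∈ sublevelOn μ φ ρ c (A n))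
    (hnear : ∀ n, IsNearOn m Q e x (zs n) (A n)) :
    ∃ u ∈ hull m (orlicz m0 μ φ), IsNearOn m Q e x u univ ∧ extension m φ ρ u ≤ c := by
  obtain ⟨u, hu, P, hP, huP, hPA⟩ := exists_mem_hull_eq_on_cover hm hA hAU fun n => (hzs n).1
  have ae_of_ae {p : Ω → Prop} {n : ℕ} (h : ∀ᵐ ω ∂μ.restrict (A n), p ω) :
      ∀ᵐ ω ∂μ.restrict (P n), p ω := by
    filter_upwards [ae_restrict_of_ae ((ae_restrict_iff' (hm _ (hA n))).1 h), hPA n]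
      with ω hp hω using hp hω
  refine ⟨u, hu, fun q hq => ?_, AEEqFun.coeFn_le.1 (hP.ae_of_forall fun n => ?_)⟩
  · rw [Measure.restrict_univ]
    exact hP.ae_of_forall fun n => IsNearOn.congr hm hφ hQ hx (subset_hull _ (hzs n).1) hu
      (hP.1 n) (huP n) (fun q hq => ae_of_ae (hnear n q hq)) q hq
  · filter_upwards [stableExt_eq_on hm (hρ.isLocalOn hm) hu (hzs n).1 (hP.1 n) (huP n),
      ae_of_ae (hzs n).2] with ω h1 h2
    exact h1.trans_le h2

theorem exists_set_avoiding_sublevel (hm : m ≤ m0) [IsFiniteMeasure μ] (hφ : Monotone φ)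
    (hρ : IsCondConvexRiskMeasure m μ φ ψ ρ) (hQ : ↑Q ⊆ hull m (orlicz m0 μ (conj φ)))
    (hx : x ∈ orlicz m0 μ φ)
    (havoid : ∀ u ∈ hull m (orlicz m0 μ φ),
      IsNearOn m Q e x u univ → ¬ extension m φ ρ u ≤ c) :
    ∃ S, MeasurableSet[m] S ∧ μ S ≠ 0 ∧ ∀ A ⊆ S, MeasurableSet[m] A →
      ∀ z ∈ sublevelOn μ φ ρ c A, IsNearOn m Q e x z A → μ A = 0 := by
  let ι := {p : Set Ω × (Ω →ₘ[μ] ℝ) // MeasurableSet[m] p.1 ∧ p.2 ∈ sublevelOn μ φ ρ c p.1 ∧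
    IsNearOn m Q e x p.2 p.1}
  have : Nonempty ι := ⟨⟨⟨∅, x⟩, @MeasurableSet.empty _ m, ⟨hx, by simp⟩,
    fun q _ => by simp⟩⟩
  obtain ⟨s, hs⟩ := exists_seq_forall_measure_diff_iUnion_eq_zero (μ := μ)
    (A := fun i : ι => i.1.1) fun i => hm _ i.2.1
  refine ⟨(⋃ n, (s n).1.1)ᶜ, (MeasurableSet.iUnion fun n => (s n).2.1).compl, fun h0 => ?_,
    fun A hAS hA z hz hnear => ?_⟩
  · obtain ⟨u, hu, hnear, hle⟩ := exists_near_mem_sublevel_of_cover hm hφ hρ hQ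
      (subset_hull _ hx) (fun n => (s n).2.1) h0 (fun n => (s n).2.2.1) fun n => (s n).2.2.2
    exact havoid u hu hnear hle
  · have h := hs ⟨⟨A, z⟩, hA, hz, hnear⟩
    rwa [sdiff_eq_left.2 (disjoint_left.2 fun ω hω => hAS hω)] at h

theorem exists_subset_avoiding_sublevel (hm : m ≤ m0) [IsFiniteMeasure μ] (hφ : Monotone φ)
    (hρ : IsCondConvexRiskMeasure m μ φ ψ ρ)
    (hlsc : WeakLSC m μ (hull m (orlicz m0 μ φ)) (hull m (orlicz m0 μ (conj φ)))
      (extension m φ ρ))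
    (hx : x ∈ orlicz m0 μ φ) (hc : c ∈ L0 m μ) (hcρ : ∀ᵐ ω ∂μ, c ω < ρ x ω) {B : Set Ω}
    (hBm : MeasurableSet[m] B) (hB : μ B ≠ 0) :
    ∃ S ⊆ B, MeasurableSet[m] S ∧ μ S ≠ 0 ∧ ∃ Q : Finset (Ω →ₘ[μ] ℝ),
      ↑Q ⊆ hull m (orlicz m0 μ (conj φ)) ∧ ∃ e ∈ L0pp m μ, ∀ A ⊆ S, MeasurableSet[m] A →
        ∀ z ∈ sublevelOn μ φ ρ c A, IsNearOn m Q e x z A → μ A = 0 := by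
  have hB' := hm _ hBm
  set c' := glue hB' c (ρ x)
  have hnot : ¬ extension m φ ρ x ≤ c' := by
    rw [extension, stableExt_eq hm (hρ.isLocalOn hm) hx, ← AEEqFun.coeFn_le]
    intro h
    refine hB (measure_eq_zero_iff_ae_notMem.2 ?_)
    filter_upwards [h, (ae_restrict_iff' hB').1 (glue_eq_on hB' c (ρ x)), hcρ] with ω h1 h2 h3 hω
    exact (h1.trans_eq (h2 hω)).not_gt h3
  obtain ⟨Q, hQ, e, he, hQe⟩ := weakLSC_iff.1 hlsc c'
    (glue_mem_L0 hBm hB' hc (hρ.mem_L0 hx)) x (subset_hull _ hx) hnot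
  obtain ⟨S, hSm, hS, hSavoid⟩ := exists_set_avoiding_sublevel (c := c') hm hφ hρ hQ hx
    fun u hu hnear => hQe u hu fun q hq => by simpa only [Measure.restrict_univ] using hnear q hq
  have hSB : μ (S \ B) = 0 := by
    refine hSavoid _ sdiff_subset (hSm.diff hBm) x ⟨hx, ?_⟩
      (isNearOn_self hm hφ hQ he (subset_hull _ hx))
    exact (eq_on_mono (fun ω hω => hω.2) (glue_eq_on_compl hB' c (ρ x))).symm.le
  refine ⟨S ∩ B, inter_subset_right, hSm.inter hBm, ?_, Q, hQ, e, he,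
    fun A hA hAm z hz hnear => hSavoid A (hA.trans inter_subset_left) hAm z ⟨hz.1, ?_⟩ hnear⟩
  · rwa [measure_inter_conull' hSB]
  · exact EventuallyLE.trans_eq hz.2
      (eq_on_mono (hA.trans inter_subset_right) (glue_eq_on hB' c (ρ x))).symm

theorem exists_finset_avoiding_sublevel (hm : m ≤ m0) [IsFiniteMeasure μ] (hφ : Monotone φ)
    (hρ : IsCondConvexRiskMeasure m μ φ ψ ρ)
    (hlsc : WeakLSC m μ (hull m (orlicz m0 μ φ)) (hull m (orlicz m0 μ (conj φ)))
      (extension m φ ρ))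
    (hx : x ∈ orlicz m0 μ φ) (hc : c ∈ L0 m μ) (hcρ : ∀ᵐ ω ∂μ, c ω < ρ x ω) {B : Set Ω}
    (hBm : MeasurableSet[m] B) (hB : μ B ≠ 0) :
    ∃ D ⊆ B, MeasurableSet[m] D ∧ μ D ≠ 0 ∧ ∃ R : Finset (Ω →ₘ[μ] ℝ),
      ↑R ⊆ orlicz m0 μ (conj φ) ∧ ∃ e ∈ L0pp m μ, ∀ z ∈ sublevelOn μ φ ρ c D,
        ∀ᵐ ω ∂μ.restrict D, ∃ r ∈ R, e ω < |condE m μ ((z - x) * r) ω| := by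
  obtain ⟨S, hSB, hSm, hS, Q, hQ, e, he, hSavoid⟩ :=
    exists_subset_avoiding_sublevel hm hφ hρ hlsc hx hc hcρ hBm hB
  obtain ⟨D, hDS, hDm, hD, R, hR, hQR⟩ := exists_subset_finset_of_subset_hull Q hQ hSm hS
  refine ⟨D, hDS.trans hSB, hDm, hD, R, hR, e, he, fun z hz => ?_⟩
  obtain ⟨e', he', hee'⟩ := he.1
  let N : Set Ω := D ∩ ⋂ r ∈ R, {ω | |(μ[⇑((z - x) * r) | m]) ω| ≤ e' ω}
  have hNm : MeasurableSet[m] N := hDm.inter <| Finset.measurableSet_biInter _ fun r _ =>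
    StronglyMeasurable.measurableSet_le
      (continuous_abs.comp_stronglyMeasurable stronglyMeasurable_condExp) he'
  have hnear : IsNearOn m Q e x z N := fun q hq => by
    obtain ⟨r, hr, hqr⟩ := hQR q hq
    have hpair := condEExt_eq_on hm
      (sub_mul_mem_hull_integrable hφ (subset_hull _ hz.1) (subset_hull _ hx) (hQ hq))
      (integrable_mul_of_mem_orlicz hφ (sub_mem_orlicz hφ hz.1 hx) (hR hr)) hNm
      (mul_congr_on (ae_eq_refl ⇑(z - x)) (eq_on_mono inter_subset_left hqr))
    filter_upwards [hpair, ae_restrict_of_ae (coeFn_condE (m := m) ((z - x) * r)),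
      ae_restrict_of_ae hee', ae_restrict_mem (hm _ hNm)] with ω h1 h2 h3 hω
    rw [h1, h2, h3]
    exact mem_iInter₂.1 hω.2 r hr
  have hN : μ N = 0 := hSavoid N (inter_subset_left.trans hDS) hNm z
    ⟨hz.1, ae_restrict_of_ae_restrict_of_subset inter_subset_left hz.2⟩ hnear
  have hcoe : ∀ᵐ ω ∂μ, ∀ r ∈ R, condE m μ ((z - x) * r) ω = (μ[⇑((z - x) * r) | m]) ω :=
    (ae_ball_iff R.countable_toSet).2 fun r _ => coeFn_condE ((z - x) * r)
  rw [ae_restrict_iff' (hm _ hDm)]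
  filter_upwards [measure_eq_zero_iff_ae_notMem.1 hN, hcoe, hee'] with ω h1 h2 h3 hω
  by_contra! h
  refine h1 ⟨hω, mem_iInter₂.2 fun r hr => ?_⟩
  have := h r hr
  rwa [h2 r hr, h3] at this

end Neighbourhood

section SeparatingFunctional

variable {Ω : Type*} {m m0 : MeasurableSpace Ω} {μ : Measure[m0] Ω} {φ ψ : ℝ≥0 → ℝ≥0∞}
  {ρ : (Ω →ₘ[μ] ℝ) → (Ω →ₘ[μ] ℝ)} {D : Set Ω} {c e l x y z : Ω →ₘ[μ] ℝ}
  {R : Finset (Ω →ₘ[μ] ℝ)}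

variable (m) in
/-- The pairings `E[(z - x) q | 𝓕]` with the finitely many dual elements `q ∈ R`, as a random
vector. -/
def pairingVector (R : Finset (Ω →ₘ[μ] ℝ)) (x z : Ω →ₘ[μ] ℝ) (ω : Ω) : EuclideanSpace ℝ R :=
  WithLp.toLp 2 fun q => (μ[⇑((z - x) * q) | m]) ω

variable (m) in
/-- On the set `A`, the dual element `y` separates `x` strictly from `K`: `E[xy | 𝓕] < E[zy | 𝓕]`
for all `z ∈ K`. -/
def SeparatesOn (K : Set (Ω →ₘ[μ] ℝ)) (A : Set Ω) (x y : Ω →ₘ[μ] ℝ) : Prop :=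
  ∀ z ∈ K, ∀ᵐ ω ∂μ.restrict A, 0 < condE m μ ((z - x) * y) ω

theorem stronglyMeasurable_pairingVector : StronglyMeasurable[m] (pairingVector m R x z) :=
  (PiLp.continuous_toLp 2 _).comp_stronglyMeasurable <| Measurable.stronglyMeasurable <|
    @measurable_pi_lambda _ _ _ m _ _ fun _ => stronglyMeasurable_condExp.measurable

theorem pairingVector_apply_ae :
    ∀ᵐ ω ∂μ, ∀ q : R, pairingVector m R x z ω q = condE m μ ((z - x) * q.1) ω :=
  ae_all_iff.2 fun q => coeFn_condE ((z - x) * q.1) |>.mono fun _ h => h.symm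

theorem convexComb_mem_sublevelOn (hφ : Monotone φ) (hρ : IsCondConvexRiskMeasure m μ φ ψ ρ)
    (hl : l ∈ L0 m μ) (hl0 : 0 ≤ l) (hl1 : l ≤ 1) (hx : x ∈ sublevelOn μ φ ρ c D)
    (hz : z ∈ sublevelOn μ φ ρ c D) : l * x + (1 - l) * z ∈ sublevelOn μ φ ρ c D := by
  refine ⟨convexComb_mem_orlicz hφ hl0 hl1 hx.1 hz.1, ?_⟩
  filter_upwards [hx.2, hz.2, ae_restrict_of_ae (AEEqFun.coeFn_le.2
    (hρ.convex _ hx.1 _ hz.1 l hl hl0 hl1)), ae_restrict_of_ae (coeFn_convexComb l (ρ x) (ρ z)),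
    ae_restrict_of_ae (zero_le_iff_ae.1 hl0), ae_restrict_of_ae (le_one_iff_ae.1 hl1)]
    with ω hx hz hconv hcomb h0 h1
  calc ρ (l * x + (1 - l) * z) ω ≤ l ω * ρ x ω + (1 - l ω) * ρ z ω := hconv.trans_eq hcomb
    _ ≤ l ω * c ω + (1 - l ω) * c ω := by
      have := sub_nonneg.2 h1
      gcongr
    _ = c ω := by ring

theorem isCondConvexFamily_pairingVector (hφ : Monotone φ)
    (hρ : IsCondConvexRiskMeasure m μ φ ψ ρ) (hR : ↑R ⊆ orlicz m0 μ (conj φ))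
    (hx : x ∈ orlicz m0 μ φ) :
    IsCondConvexFamily m μ fun z : sublevelOn μ φ ρ c D => pairingVector m R x z := by
  intro z z' l hl hl0 hl1
  refine ⟨⟨_, convexComb_mem_sublevelOn hφ hρ hl hl0 hl1 z.2 z'.2⟩, ?_⟩
  have hint (w : sublevelOn μ φ ρ c D) (q : R) : Integrable ↑((w.1 - x) * q) μ :=
    integrable_mul_of_mem_orlicz hφ (sub_mem_orlicz hφ w.2.1 hx) (hR q.2)
  have hpair (q : R) : condE m μ ((l * z + (1 - l) * z' - x) * q) =
      l * condE m μ ((z - x) * q) + (1 - l) * condE m μ ((z' - x) * q) := by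
    rw [← condE_convexComb hl hl0 hl1 (hint z q) (hint z' q)]
    congr 1
    ring
  have hcomb := ae_all_iff.2 fun q : R =>
    coeFn_convexComb l (condE m μ ((z - x) * q)) (condE m μ ((z' - x) * q))
  filter_upwards [pairingVector_apply_ae (m := m) (R := R) (x := x) (z := l * z + (1 - l) * z'),
    pairingVector_apply_ae (m := m) (R := R) (x := x) (z := z),
    pairingVector_apply_ae (m := m) (R := R) (x := x) (z := z'), hcomb] with ω h h1 h2 h3
  ext q
  rw [h q, hpair q, h3 q, ← h1 q, ← h2 q]
  rfl

theorem exists_inner_pairingVector_pos (hm : m ≤ m0) [IsFiniteMeasure μ] (hφ : Monotone φ)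
    (hρ : IsCondConvexRiskMeasure m μ φ ψ ρ) (hR : ↑R ⊆ orlicz m0 μ (conj φ))
    (hx : x ∈ orlicz m0 μ φ) (hne : (sublevelOn μ φ ρ c D).Nonempty) (he : e ∈ L0pp m μ)
    (hsep : ∀ z ∈ sublevelOn μ φ ρ c D,
      ∀ᵐ ω ∂μ.restrict D, ∃ r ∈ R, e ω < |condE m μ ((z - x) * r) ω|) :
    ∃ v, StronglyMeasurable[m] v ∧ ∀ z ∈ sublevelOn μ φ ρ c D,
      ∀ᵐ ω ∂μ.restrict D, 0 < inner ℝ (v ω) (pairingVector m R x z ω) := by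
  have : Nonempty (sublevelOn μ φ ρ c D) := hne.to_subtype
  obtain ⟨v, hv, hpos⟩ := (isCondConvexFamily_pairingVector hφ hρ hR hx).exists_inner_pos hm
    (fun _ => stronglyMeasurable_pairingVector) (ae_restrict_of_ae he.2) fun z => by
      filter_upwards [hsep z z.2, ae_restrict_of_ae (pairingVector_apply_ae (R := R) (z := z.1))]
        with ω ⟨r, hr, her⟩ happly
      rw [← happly ⟨r, hr⟩] at her
      exact her.le.trans (PiLp.norm_apply_le (pairingVector m R x z ω) ⟨r, hr⟩)
  exact ⟨v, hv, fun z hz => hpos ⟨z, hz⟩⟩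

theorem exists_bounded_mem_L0_eq_on (hm : m ≤ m0) {f : Ω → ℝ} (hf : StronglyMeasurable[m] f)
    {A : Set Ω} (hA : MeasurableSet[m] A) {C : ℝ≥0} (hC : ∀ ω ∈ A, |f ω| ≤ C) :
    ∃ l ∈ L0 m μ, (∀ᵐ ω ∂μ, |l ω| ≤ C) ∧ l =ᵐ[μ.restrict A] f := by
  obtain ⟨l, hl, hlf⟩ := exists_mem_L0_ae_eq (μ := μ) hm (StronglyMeasurable.indicator hf hA)
  have hlA : l =ᵐ[μ.restrict A] A.indicator f := ae_restrict_of_ae hlf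
  refine ⟨l, hl, ?_, hlA.trans (indicator_ae_eq_restrict (hm _ hA))⟩
  filter_upwards [hlf] with ω h
  rw [h]
  by_cases hω : ω ∈ A
  · rw [indicator_of_mem hω]
    exact hC ω hω
  · rw [indicator_of_notMem hω, abs_zero]
    exact C.2

theorem exists_separatesOn (hm : m ≤ m0) [IsFiniteMeasure μ] (hφ : Monotone φ)
    (hρ : IsCondConvexRiskMeasure m μ φ ψ ρ) (hDm : MeasurableSet[m] D) (hD : μ D ≠ 0)
    (hR : ↑R ⊆ orlicz m0 μ (conj φ)) (hx : x ∈ orlicz m0 μ φ)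
    (hne : (sublevelOn μ φ ρ c D).Nonempty) (he : e ∈ L0pp m μ)
    (hsep : ∀ z ∈ sublevelOn μ φ ρ c D,
      ∀ᵐ ω ∂μ.restrict D, ∃ r ∈ R, e ω < |condE m μ ((z - x) * r) ω|) :
    ∃ A ⊆ D, MeasurableSet[m] A ∧ μ A ≠ 0 ∧ ∃ y ∈ orlicz m0 μ (conj φ),
      SeparatesOn m (sublevelOn μ φ ρ c D) A x y := by
  obtain ⟨v, hv, hpos⟩ := exists_inner_pairingVector_pos hm hφ hρ hR hx hne he hsep
  obtain ⟨A, hAD, hAm, hA, N, hN⟩ := exists_subset_bounded hDm hD hv.norm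
  choose l hl hlN hlv using fun r : R => exists_bounded_mem_L0_eq_on (μ := μ) (C := N) hm
    ((PiLp.continuous_apply 2 _ r).comp_stronglyMeasurable hv) hAm
    fun ω hω => (PiLp.norm_apply_le (v ω) r).trans ((le_abs_self _).trans (hN ω hω))
  refine ⟨A, hAD, hAm, hA, ∑ r : R, l r * r, ?_, fun z hz => ?_⟩
  · exact Finset.sum_induction _ (· ∈ orlicz m0 μ (conj φ))
      (fun _ _ => add_mem_orlicz (conj_mono φ)) (zero_mem_orlicz (conj_zero φ))
      fun r _ => mul_mem_orlicz_of_bounded (conj_mono φ) N (hlN r) (hR r.2)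
  have hint (r : R) : Integrable ↑((z - x) * r) μ :=
    integrable_mul_of_mem_orlicz hφ (sub_mem_orlicz hφ hz.1 hx) (hR r.2)
  have hsum : (z - x) * ∑ r : R, l r * r = ∑ r : R, l r * ((z - x) * r) := by
    rw [Finset.mul_sum]
    exact Finset.sum_congr rfl fun r _ => by ring
  have hmul : ∀ᵐ ω ∂μ, ∀ r : R,
      condE m μ (l r * ((z - x) * r)) ω = l r ω * condE m μ ((z - x) * r) ω :=
    ae_all_iff.2 fun r => by
      rw [condE_mul_of_bounded (hl r) N (hlN r) (hint r)]
      exact AEEqFun.coeFn_mul _ _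
  rw [hsum]
  filter_upwards [ae_restrict_of_ae_restrict_of_subset hAD (hpos z hz),
    ae_restrict_of_ae (pairingVector_apply_ae (R := R) (z := z)), ae_all_iff.2 hlv,
    ae_restrict_of_ae hmul, ae_restrict_of_ae (coeFn_condE_sum (m := m) Finset.univ
      fun r _ => integrable_mul_of_bounded N (hlN r) (hint r))] with ω h happly hlv hmul hsum
  rw [PiLp.inner_apply] at h
  rw [hsum]
  refine h.trans_eq (Finset.sum_congr rfl fun r _ => ?_)
  rw [hmul r, hlv r, happly r]
  exact Real.inner_apply _ _

end SeparatingFunctional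

section Normalisation

variable {Ω : Type*} {m m0 : MeasurableSpace Ω} {μ : Measure[m0] Ω} {φ ψ : ℝ≥0 → ℝ≥0∞}
  {ρ : (Ω →ₘ[μ] ℝ) → (Ω →ₘ[μ] ℝ)} {A B D : Set Ω} {c k l w x x₀ y z z₀ : Ω →ₘ[μ] ℝ}

theorem one_mem_orlicz [IsFiniteMeasure μ] (hφ : Monotone φ) (h0 : ∃ t, 0 < t ∧ φ t < ∞) :
    (1 : Ω →ₘ[μ] ℝ) ∈ orlicz m0 μ φ :=
  mem_orlicz_of_bounded hφ h0 one_mem_L0 1 <| by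
    filter_upwards [AEEqFun.coeFn_one (β := ℝ) (μ := μ)] with ω h
    rw [h, Pi.one_apply, abs_one, NNReal.coe_one]

theorem ind_mem_orlicz [IsFiniteMeasure μ] (hφ : Monotone φ) (h0 : ∃ t, 0 < t ∧ φ t < ∞)
    (hA : MeasurableSet A) : ind μ hA ∈ orlicz m0 μ φ :=
  mem_orlicz_of_bounded hφ h0 (mem_L0_top _) 1 <| by
    filter_upwards [zero_le_iff_ae.1 (ind_nonneg hA), le_one_iff_ae.1 (ind_le_one hA)]
      with ω h0 h1
    rwa [abs_of_nonneg h0]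

theorem neg_mem_orlicz (hφ : Monotone φ) (hφ0 : φ 0 = 0) (hx : x ∈ orlicz m0 μ φ) :
    -x ∈ orlicz m0 μ φ := by
  rw [← zero_sub]
  exact sub_mem_orlicz hφ (zero_mem_orlicz hφ0) hx

theorem integrable_of_mem_orlicz_conj [IsFiniteMeasure μ] (hφ : Monotone φ)
    (h0 : ∃ t, 0 < t ∧ φ t < ∞) (hy : y ∈ orlicz m0 μ (conj φ)) : Integrable y μ := by
  rw [← one_mul y]
  exact integrable_mul_of_mem_orlicz hφ (one_mem_orlicz hφ h0) hy

theorem exists_subset_eq_bounded (hm : m ≤ m0) (hk : k ∈ L0 m μ) (hBm : MeasurableSet[m] B)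
    (hB : μ B ≠ 0) :
    ∃ D ⊆ B, MeasurableSet[m] D ∧ μ D ≠ 0 ∧ ∃ l ∈ L0 m μ, ∃ C : ℝ≥0,
      (∀ᵐ ω ∂μ, |l ω| ≤ C) ∧ l =ᵐ[μ.restrict D] k := by
  obtain ⟨f, hf, hkf⟩ := hk
  obtain ⟨D, hDB, hDm, hD, N, hN⟩ := exists_subset_bounded hBm hB hf
  obtain ⟨l, hl, hlN, hlf⟩ := exists_bounded_mem_L0_eq_on (μ := μ) (C := N) hm hf hDm hN
  have hkf' : k =ᵐ[μ.restrict D] f := ae_restrict_of_ae hkf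
  exact ⟨D, hDB, hDm, hD, l, hl, N, hlN, hlf.trans hkf'.symm⟩

theorem ae_eq_zero_of_condE_nonpos (hm : m ≤ m0) [IsFiniteMeasure μ] (hx : Integrable x μ)
    (hA : MeasurableSet[m] A) (h0 : ∀ᵐ ω ∂μ.restrict A, 0 ≤ x ω)
    (hE : ∀ᵐ ω ∂μ.restrict A, condE m μ x ω ≤ 0) : ∀ᵐ ω ∂μ.restrict A, x ω = 0 := by
  refine (setIntegral_eq_zero_iff_of_nonneg_ae h0 hx.integrableOn).1
    (le_antisymm ?_ (integral_nonneg_of_ae h0))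
  rw [← setIntegral_condExp hm hx hA, ← setIntegral_congr_ae (hm _ hA)
    ((coeFn_condE x).mono fun ω h _ => h)]
  exact integral_nonpos_of_ae hE

theorem add_mem_sublevelOn (hφ : Monotone φ) (hρ : IsCondConvexRiskMeasure m μ φ ψ ρ)
    (hz : z ∈ sublevelOn μ φ ρ c D) (hw : w ∈ orlicz m0 μ φ) (hw0 : 0 ≤ w) :
    z + w ∈ sublevelOn μ φ ρ c D := by
  have hle : z ≤ z + w := by
    rw [← AEEqFun.coeFn_le]
    filter_upwards [AEEqFun.coeFn_add z w, zero_le_iff_ae.1 hw0] with ω h h0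
    rw [h]
    exact le_add_of_nonneg_right h0
  refine ⟨add_mem_orlicz hφ hz.1 hw, ?_⟩
  filter_upwards [hz.2, ae_restrict_of_ae (AEEqFun.coeFn_le.2
    (hρ.antitone _ hz.1 _ (add_mem_orlicz hφ hz.1 hw) hle))] with ω h1 h2
  exact h2.trans h1

theorem nonneg_of_forall_natCast_mul_add_pos {a b : ℝ} (h : ∀ n : ℕ, 0 < a + n * b) : 0 ≤ b := by
  by_contra! hb
  obtain ⟨n, hn⟩ := exists_nat_gt (a / -b)
  rw [div_lt_iff₀ (neg_pos.2 hb)] at hn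
  linarith [h n]

theorem SeparatesOn.condE_mul_nonneg (hφ : Monotone φ) (hρ : IsCondConvexRiskMeasure m μ φ ψ ρ)
    (hx₀ : x₀ ∈ orlicz m0 μ φ) (hy : y ∈ orlicz m0 μ (conj φ)) (hz₀ : z₀ ∈ sublevelOn μ φ ρ c D)
    (hsep : SeparatesOn m (sublevelOn μ φ ρ c D) A x₀ y) (hw : w ∈ orlicz m0 μ φ) (hw0 : 0 ≤ w) :
    ∀ᵐ ω ∂μ.restrict A, 0 ≤ condE m μ (w * y) ω := by
  have hray (n : ℕ) : ∃ z ∈ sublevelOn μ φ ρ c D, ∀ᵐ ω ∂μ,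
      condE m μ ((z - x₀) * y) ω =
        condE m μ ((z₀ - x₀) * y) ω + n * condE m μ (w * y) ω := by
    induction n with
    | zero => exact ⟨z₀, hz₀, ae_of_all _ fun ω => by simp⟩
    | succ n ih =>
      obtain ⟨z, hz, hzn⟩ := ih
      refine ⟨z + w, add_mem_sublevelOn hφ hρ hz hw hw0, ?_⟩
      rw [show (z + w - x₀) * y = (z - x₀) * y + w * y by ring,
        condE_add (integrable_mul_of_mem_orlicz hφ (sub_mem_orlicz hφ hz.1 hx₀) hy)
          (integrable_mul_of_mem_orlicz hφ hw hy)]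
      filter_upwards [hzn, AEEqFun.coeFn_add (condE m μ ((z - x₀) * y)) (condE m μ (w * y))]
        with ω h hadd
      rw [hadd, Pi.add_apply, h]
      push_cast
      ring
  have hpos : ∀ᵐ ω ∂μ.restrict A, ∀ n : ℕ,
      0 < condE m μ ((z₀ - x₀) * y) ω + n * condE m μ (w * y) ω :=
    ae_all_iff.2 fun n => by
      obtain ⟨z, hz, hzn⟩ := hray n
      filter_upwards [hsep z hz, ae_restrict_of_ae hzn] with ω h1 h2
      exact h1.trans_eq h2
  exact hpos.mono fun ω => nonneg_of_forall_natCast_mul_add_pos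

theorem SeparatesOn.nonneg (hm : m ≤ m0) [IsFiniteMeasure μ] (hφ : Monotone φ)
    (h0 : ∃ t, 0 < t ∧ φ t < ∞) (hρ : IsCondConvexRiskMeasure m μ φ ψ ρ)
    (hA : MeasurableSet[m] A) (hx₀ : x₀ ∈ orlicz m0 μ φ) (hy : y ∈ orlicz m0 μ (conj φ))
    (hz₀ : z₀ ∈ sublevelOn μ φ ρ c D)
    (hsep : SeparatesOn m (sublevelOn μ φ ρ c D) A x₀ y) : ∀ᵐ ω ∂μ.restrict A, 0 ≤ y ω := by
  have hs : MeasurableSet {ω | y ω < 0} := measurableSet_lt y.measurable measurable_const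
  set w : Ω →ₘ[μ] ℝ := ind μ hs
  have hw : w ∈ orlicz m0 μ φ := ind_mem_orlicz hφ h0 hs
  have hcoe : ∀ᵐ ω ∂μ, (-(w * y)) ω = -({ω | y ω < 0}.indicator 1 ω * y ω) := by
    filter_upwards [AEEqFun.coeFn_neg (w * y), AEEqFun.coeFn_mul w y, coeFn_ind hs] with ω h1 h2 h3
    rw [h1, Pi.neg_apply, h2, Pi.mul_apply, h3]
  have hint : Integrable ↑(-(w * y)) μ :=
    (integrable_mul_of_mem_orlicz hφ hw hy).neg.congr (AEEqFun.coeFn_neg _).symm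
  have hnonneg : ∀ᵐ ω ∂μ.restrict A, 0 ≤ (-(w * y)) ω := by
    filter_upwards [ae_restrict_of_ae hcoe] with ω h
    rw [h]
    by_cases hω : y ω < 0
    · simpa [hω] using hω.le
    · simp [hω]
  have hzero := ae_eq_zero_of_condE_nonpos hm hint hA hnonneg <| by
    rw [condE_neg]
    filter_upwards [hsep.condE_mul_nonneg hφ hρ hx₀ hy hz₀ hw (ind_nonneg hs),
      ae_restrict_of_ae (AEEqFun.coeFn_neg (condE m μ (w * y)))] with ω h1 h2
    rw [h2]
    exact neg_nonpos.2 h1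
  filter_upwards [hzero, ae_restrict_of_ae hcoe] with ω h1 h2
  by_contra! hω
  rw [h2, indicator_of_mem (s := {ω | y ω < 0}) hω, Pi.one_apply, one_mul] at h1
  linarith

theorem SeparatesOn.condE_pos (hm : m ≤ m0) [IsFiniteMeasure μ] (hφ : Monotone φ)
    (h0 : ∃ t, 0 < t ∧ φ t < ∞) (hρ : IsCondConvexRiskMeasure m μ φ ψ ρ)
    (hA : MeasurableSet[m] A) (hx₀ : x₀ ∈ orlicz m0 μ φ) (hy : y ∈ orlicz m0 μ (conj φ))
    (hz₀ : z₀ ∈ sublevelOn μ φ ρ c D)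
    (hsep : SeparatesOn m (sublevelOn μ φ ρ c D) A x₀ y) :
    ∀ᵐ ω ∂μ.restrict A, 0 < condE m μ y ω := by
  set B : Set Ω := A ∩ {ω | (μ[⇑y | m]) ω ≤ 0}
  have hB : MeasurableSet[m] B := hA.inter <|
    (stronglyMeasurable_condExp (f := ⇑y) (μ := μ)).measurable measurableSet_Iic
  have hBA {p : Ω → Prop} (h : ∀ᵐ ω ∂μ.restrict A, p ω) : ∀ᵐ ω ∂μ.restrict B, p ω :=
    ae_restrict_of_ae_restrict_of_subset inter_subset_left h
  have hyB : ∀ᵐ ω ∂μ.restrict B, y ω = 0 := by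
    refine ae_eq_zero_of_condE_nonpos hm (integrable_of_mem_orlicz_conj hφ h0 hy) hB
      (hBA (hsep.nonneg hm hφ h0 hρ hA hx₀ hy hz₀)) ?_
    filter_upwards [ae_restrict_mem (hm _ hB), ae_restrict_of_ae (coeFn_condE (m := m) y)]
      with ω hω h
    rw [h]
    exact hω.2
  have hcondE : condE m μ ((z₀ - x₀) * y) =ᵐ[μ.restrict B] condE m μ 0 := by
    refine isLocalOn_condE _ (integrable_mul_of_mem_orlicz hφ (sub_mem_orlicz hφ hz₀.1 hx₀) hy) _
      ((integrable_zero Ω ℝ μ).congr AEEqFun.coeFn_zero.symm) B hB ?_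
    filter_upwards [hyB, ae_restrict_of_ae (AEEqFun.coeFn_mul (z₀ - x₀) y),
      ae_restrict_of_ae (AEEqFun.coeFn_zero (β := ℝ) (μ := μ))] with ω h1 h2 h3
    rw [h2, h3, Pi.mul_apply, h1, mul_zero, Pi.zero_apply]
  have hempty : ∀ᵐ _ ∂μ.restrict B, False := by
    rw [condE_zero] at hcondE
    filter_upwards [hcondE, hBA (hsep z₀ hz₀),
      ae_restrict_of_ae (AEEqFun.coeFn_zero (β := ℝ) (μ := μ))] with ω h1 h2 h3
    rw [h1, h3] at h2
    exact lt_irrefl _ h2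
  rw [ae_restrict_iff' (hm _ hA)]
  filter_upwards [(ae_restrict_iff' (hm _ hB)).1 hempty, coeFn_condE (m := m) y] with ω h1 h2 hω
  rw [h2]
  exact not_le.1 fun h => h1 ⟨hω, h⟩

theorem IsCondConvexRiskMeasure.exists_cash_shift (hm : m ≤ m0) [IsFiniteMeasure μ]
    (hφ : Monotone φ) (h0 : ∃ t, 0 < t ∧ φ t < ∞) (hρ : IsCondConvexRiskMeasure m μ φ ψ ρ)
    (hx : x ∈ orlicz m0 μ φ) (hc : c ∈ L0 m μ) (hBm : MeasurableSet[m] B) (hB : μ B ≠ 0) :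
    ∃ D ⊆ B, MeasurableSet[m] D ∧ μ D ≠ 0 ∧ ∃ l ∈ L0 m μ, ∃ C : ℝ≥0, (∀ᵐ ω ∂μ, |l ω| ≤ C) ∧
      x + l ∈ orlicz m0 μ φ ∧ l =ᵐ[μ.restrict D] ↑(ρ x - c) ∧ ρ (x + l) =ᵐ[μ.restrict D] c := by
  obtain ⟨D, hDB, hDm, hD, l, hl, C, hlC, hlD⟩ :=
    exists_subset_eq_bounded hm (sub_mem_L0 (hρ.mem_L0 hx) hc) hBm hB
  have hlφ : l ∈ orlicz m μ φ := mem_orlicz_of_bounded hφ h0 hl C hlC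
  refine ⟨D, hDB, hDm, hD, l, hl, C, hlC, add_mem_orlicz hφ hx (orlicz_mono_measurableSpace hlφ),
    hlD, ?_⟩
  rw [hρ.cash x hx l hlφ]
  have h := sub_congr_on (ae_eq_refl ⇑(ρ x)) hlD
  rwa [sub_sub_cancel] at h

theorem glue_mem_sublevelOn (hm : m ≤ m0) (hφ : Monotone φ)
    (hρ : IsCondConvexRiskMeasure m μ φ ψ ρ) (hA : MeasurableSet[m] A) (hx : x ∈ orlicz m0 μ φ)
    (hxc : ρ x ≤ᵐ[μ.restrict A] c) (hz : z ∈ sublevelOn μ φ ρ c D) :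
    glue (hm _ hA) x z ∈ sublevelOn μ φ ρ c D := by
  have hg : glue (hm _ hA) x z ∈ orlicz m0 μ φ := glue_mem_orlicz hφ _ hx hz.1
  have hA' := hm _ hA
  refine ⟨hg, ae_of_ae_on_of_ae_on_compl hA' ?_ ?_⟩
  · rw [Measure.restrict_restrict hA']
    exact ae_restrict_of_ae_restrict_of_subset inter_subset_left <|
      (hρ.isLocalOn hm _ hg _ hx A hA (glue_eq_on hA' x z)).trans_le hxc
  · rw [Measure.restrict_restrict hA'.compl]
    filter_upwards [ae_restrict_of_ae_restrict_of_subset inter_subset_right hz.2,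
      ae_restrict_of_ae_restrict_of_subset inter_subset_left
        (hρ.isLocalOn hm _ hg _ hz.1 Aᶜ hA.compl (glue_eq_on_compl hA' x z))] with ω h1 h2
    exact h2.trans_le h1

theorem SeparatesOn.condE_lt (hm : m ≤ m0) [IsFiniteMeasure μ] (hφ : Monotone φ)
    (h0 : ∃ t, 0 < t ∧ φ t < ∞) (hρ : IsCondConvexRiskMeasure m μ φ ψ ρ)
    (hA : MeasurableSet[m] A) (hx₀ : x₀ ∈ orlicz m0 μ φ) (hc : c ∈ L0 m μ)
    (hy : y ∈ orlicz m0 μ (conj φ)) (hz₀ : z₀ ∈ sublevelOn μ φ ρ c D)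
    (hsep : SeparatesOn m (sublevelOn μ φ ρ c D) A x₀ y) (hx : x ∈ orlicz m0 μ φ) :
    ∀ᵐ ω ∂μ.restrict A,
      condE m μ (x₀ * y) ω < condE m μ (x * y) ω + (ρ x ω - c ω) * condE m μ y ω := by
  refine ae_restrict_of_forall_exists_subset hm hA fun B hBA hBm hB => ?_
  obtain ⟨G, hGB, hGm, hG, l, hl, C, hlC, hxl, hlG, hρG⟩ :=
    hρ.exists_cash_shift hm hφ h0 hx hc hBm hB
  refine ⟨G, hGB, hGm, hG, ?_⟩
  have hG' := hm _ hGm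
  have hz := glue_mem_sublevelOn hm hφ hρ hGm hxl hρG.le hz₀
  set z := glue hG' (x + l) z₀
  have hint {u : Ω →ₘ[μ] ℝ} (hu : u ∈ orlicz m0 μ φ) : Integrable ↑(u * y) μ :=
    integrable_mul_of_mem_orlicz hφ hu hy
  have hyint := integrable_of_mem_orlicz_conj hφ h0 hy
  have hlocal : condE m μ ((z - x₀) * y) =ᵐ[μ.restrict G] condE m μ ((x + l - x₀) * y) :=
    isLocalOn_condE _ (hint (sub_mem_orlicz hφ hz.1 hx₀)) _ (hint (sub_mem_orlicz hφ hxl hx₀)) G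
      hGm (mul_congr_on (sub_congr_on (glue_eq_on hG' _ _) (ae_eq_refl ⇑x₀)) (ae_eq_refl ⇑y))
  have hexpand : condE m μ ((x + l - x₀) * y) =
      condE m μ (x * y) + l * condE m μ y - condE m μ (x₀ * y) := by
    have hly := integrable_mul_of_bounded C hlC hyint
    rw [show (x + l - x₀) * y = x * y + l * y - x₀ * y by ring,
      condE_sub (integrable_add_class (hint hx) hly) (hint hx₀), condE_add (hint hx) hly,
      condE_mul_of_bounded hl C hlC hyint]
  rw [hexpand] at hlocal
  filter_upwards [ae_restrict_of_ae_restrict_of_subset (hGB.trans hBA) (hsep z hz), hlocal, hlG,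
    ae_restrict_of_ae (AEEqFun.coeFn_sub (ρ x) c),
    ae_restrict_of_ae (AEEqFun.coeFn_sub (condE m μ (x * y) + l * condE m μ y) _),
    ae_restrict_of_ae (AEEqFun.coeFn_add (condE m μ (x * y)) (l * condE m μ y)),
    ae_restrict_of_ae (AEEqFun.coeFn_mul l (condE m μ y))] with ω hpos h1 h2 h3 h4 h5 h6
  rw [h1, h4, Pi.sub_apply, h5, Pi.add_apply, h6, Pi.mul_apply, h2, h3] at hpos
  exact sub_pos.1 hpos

theorem exists_bounded_mul_condE_eq_neg_one (hm : m ≤ m0) (hAm : MeasurableSet[m] A) (hA : μ A ≠ 0)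
    (hypos : ∀ᵐ ω ∂μ.restrict A, 0 < condE m μ y ω) :
    ∃ B ⊆ A, MeasurableSet[m] B ∧ μ B ≠ 0 ∧ ∃ l ∈ L0 m μ, ∃ C : ℝ≥0, (∀ᵐ ω ∂μ, |l ω| ≤ C) ∧
      ∀ᵐ ω ∂μ.restrict B, l ω * condE m μ y ω = -1 := by
  obtain ⟨k, hk, hky⟩ := exists_mem_L0_ae_eq (μ := μ) hm
    (stronglyMeasurable_condExp (f := ⇑y) (μ := μ)).measurable.inv.neg.stronglyMeasurable
  obtain ⟨B, hBA, hBm, hB, l, hl, C, hlC, hlk⟩ := exists_subset_eq_bounded hm hk hAm hA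
  refine ⟨B, hBA, hBm, hB, l, hl, C, hlC, ?_⟩
  filter_upwards [hlk, ae_restrict_of_ae hky, ae_restrict_of_ae (coeFn_condE (m := m) y),
    ae_restrict_of_ae_restrict_of_subset hBA hypos] with ω h1 h2 h3 hpos
  rw [h1, h2, Pi.neg_apply, Pi.inv_apply, ← h3, neg_mul, inv_mul_cancel₀ hpos.ne']

theorem condE_neg_one (hm : m ≤ m0) [IsFiniteMeasure μ] : condE m μ (-1 : Ω →ₘ[μ] ℝ) = -1 := by
  rw [condE_neg, condE_of_mem_L0 hm one_mem_L0
    ((integrable_const 1).congr AEEqFun.coeFn_one.symm)]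

theorem coeFn_neg_one : ⇑(-1 : Ω →ₘ[μ] ℝ) =ᵐ[μ] fun _ => -1 :=
  (AEEqFun.coeFn_neg _).trans AEEqFun.coeFn_one.neg

theorem condE_mul_eq_on_of_eq_mul (hφ : Monotone φ) (hx : x ∈ orlicz m0 μ φ)
    (hy : y ∈ orlicz m0 μ (conj φ)) (hw : w ∈ orlicz m0 μ (conj φ)) (hl : l ∈ L0 m μ) (C : ℝ≥0)
    (hlC : ∀ᵐ ω ∂μ, |l ω| ≤ C) (hA : MeasurableSet[m] A) (h : w =ᵐ[μ.restrict A] ↑(l * y)) :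
    condE m μ (x * w) =ᵐ[μ.restrict A] fun ω => l ω * condE m μ (x * y) ω := by
  have hxy : Integrable ↑(x * y) μ := integrable_mul_of_mem_orlicz hφ hx hy
  have hlocal := isLocalOn_condE (m := m) _ (integrable_mul_of_mem_orlicz hφ hx hw) _
    (integrable_mul_of_bounded C hlC hxy) A hA <| by
      rw [show l * (x * y) = x * (l * y) by ring]
      exact mul_congr_on (ae_eq_refl ⇑x) h
  rw [condE_mul_of_bounded hl C hlC hxy] at hlocal
  exact hlocal.trans (ae_restrict_of_ae (AEEqFun.coeFn_mul l (condE m μ (x * y))))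

theorem exists_normalized_dual (hm : m ≤ m0) [IsFiniteMeasure μ] (hφ : IsYoung φ)
    (hAm : MeasurableSet[m] A) (hA : μ A ≠ 0) (hy : y ∈ orlicz m0 μ (conj φ))
    (hy0 : ∀ᵐ ω ∂μ.restrict A, 0 ≤ y ω) (hypos : ∀ᵐ ω ∂μ.restrict A, 0 < condE m μ y ω) :
    ∃ B ⊆ A, MeasurableSet[m] B ∧ μ B ≠ 0 ∧ ∃ η ∈ orlicz m0 μ (conj φ), condE m μ η = -1 ∧ η ≤ 0 ∧
      ∀ x ∈ orlicz m0 μ φ, ∀ᵐ ω ∂μ.restrict B,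
        condE m μ y ω * condE m μ (x * η) ω = -condE m μ (x * y) ω := by
  obtain ⟨B, hBA, hBm, hB, l, hl, C, hlC, hly⟩ :=
    exists_bounded_mul_condE_eq_neg_one hm hAm hA hypos
  have hB' := hm _ hBm
  have hint {w : Ω →ₘ[μ] ℝ} (hw : w ∈ orlicz m0 μ (conj φ)) : Integrable w μ :=
    integrable_of_mem_orlicz_conj hφ.mono hφ.exists_pos_lt_top hw
  have hlyφ : l * y ∈ orlicz m0 μ (conj φ) := mul_mem_orlicz_of_bounded (conj_mono φ) C hlC hy
  have hneg : (-1 : Ω →ₘ[μ] ℝ) ∈ orlicz m0 μ (conj φ) := neg_mem_orlicz (conj_mono φ) (conj_zero φ)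
    (one_mem_orlicz (conj_mono φ) hφ.exists_pos_conj_lt_top)
  have hη : glue hB' (l * y) (-1) ∈ orlicz m0 μ (conj φ) :=
    glue_mem_orlicz (conj_mono φ) hB' hlyφ hneg
  refine ⟨B, hBA, hBm, hB, _, hη, ?_, glue_le hB' ?_ ?_, fun x hx => ?_⟩
  · rw [condE_glue hBm hB' (hint hlyφ) (hint hneg), condE_mul_of_bounded hl C hlC (hint hy),
      condE_neg_one hm]
    refine glue_eq_right hB' ?_
    filter_upwards [hly, ae_restrict_of_ae (AEEqFun.coeFn_mul l (condE m μ y)),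
      ae_restrict_of_ae coeFn_neg_one] with ω h1 h2 h3
    rw [h2, h3, Pi.mul_apply, h1]
  · filter_upwards [hly, ae_restrict_of_ae (AEEqFun.coeFn_mul l y),
      ae_restrict_of_ae_restrict_of_subset hBA hy0, ae_restrict_of_ae_restrict_of_subset hBA hypos,
      ae_restrict_of_ae (AEEqFun.coeFn_zero (β := ℝ) (μ := μ))] with ω h1 h2 hy0 hpos h3
    have hl0 : l ω ≤ 0 := by
      by_contra! hl0
      linarith [mul_pos hl0 hpos]
    rw [h2, h3]
    exact mul_nonpos_of_nonpos_of_nonneg hl0 hy0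
  · filter_upwards [ae_restrict_of_ae coeFn_neg_one,
      ae_restrict_of_ae (AEEqFun.coeFn_zero (β := ℝ) (μ := μ))] with ω h1 h2
    rw [h1, h2]
    exact neg_one_lt_zero.le
  · filter_upwards [condE_mul_eq_on_of_eq_mul hφ.mono hx hy hη hl C hlC hBm (glue_eq_on hB' _ _),
      hly] with ω h1 h2
    rw [h1]
    linear_combination condE m μ (x * y) ω * h2

theorem exists_feasible_dual_of_separatesOn (hm : m ≤ m0) [IsFiniteMeasure μ] (hφ : IsYoung φ)
    (hρ : IsCondConvexRiskMeasure m μ φ ψ ρ) (hAm : MeasurableSet[m] A) (hA : μ A ≠ 0)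
    (hx₀ : x₀ ∈ orlicz m0 μ φ) (hc : c ∈ L0 m μ) (hy : y ∈ orlicz m0 μ (conj φ))
    (hz₀ : z₀ ∈ sublevelOn μ φ ρ c D)
    (hsep : SeparatesOn m (sublevelOn μ φ ρ c D) A x₀ y) :
    ∃ B ⊆ A, MeasurableSet[m] B ∧ μ B ≠ 0 ∧ ∃ η ∈ orlicz m0 μ (conj φ), condE m μ η = -1 ∧ η ≤ 0 ∧
      ∀ x ∈ orlicz m0 μ φ, ∀ᵐ ω ∂μ.restrict B,
        condE m μ (x * η) ω - ρ x ω ≤ condE m μ (x₀ * η) ω - c ω := by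
  have h0 := hφ.exists_pos_lt_top
  have hpos := hsep.condE_pos hm hφ.mono h0 hρ hAm hx₀ hy hz₀
  obtain ⟨B, hBA, hBm, hB, η, hη, hη1, hη0, hηy⟩ := exists_normalized_dual hm hφ hAm hA hy
    (hsep.nonneg hm hφ.mono h0 hρ hAm hx₀ hy hz₀) hpos
  refine ⟨B, hBA, hBm, hB, η, hη, hη1, hη0, fun x hx => ?_⟩
  filter_upwards [hηy x hx, hηy x₀ hx₀, ae_restrict_of_ae_restrict_of_subset hBA hpos,
    ae_restrict_of_ae_restrict_of_subset hBA
      (hsep.condE_lt hm hφ.mono h0 hρ hAm hx₀ hc hy hz₀ hx)] with ω h1 h2 hpos hlt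
  refine le_of_mul_le_mul_left ?_ hpos
  linarith

end Normalisation

section EssentialSupremum

variable {Ω : Type*} {m0 : MeasurableSpace Ω} {μ : Measure[m0] Ω} {a r x y : Ω →ₘ[μ] ℝ}
  {F G : Ω →ₘ[μ] EReal} {A : Set Ω}

theorem coeFn_toE (x : Ω →ₘ[μ] ℝ) : toE x =ᵐ[μ] fun ω => (x ω : EReal) :=
  AEEqFun.coeFn_comp _ _ _

theorem coeFn_toE_sub (x y : Ω →ₘ[μ] ℝ) : ∀ᵐ ω ∂μ, toE (x - y) ω = ((x ω - y ω : ℝ) : EReal) := by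
  filter_upwards [coeFn_toE (x - y), AEEqFun.coeFn_sub x y] with ω h1 h2
  rw [h1, h2, Pi.sub_apply]

theorem coeFn_subE (x : Ω →ₘ[μ] ℝ) (F : Ω →ₘ[μ] EReal) :
    subE x F =ᵐ[μ] fun ω => (x ω : EReal) - F ω := by
  filter_upwards [AEEqFun.coeFn_comp₂Measurable (fun a b : EReal => a - b) measurable_ereal_sub
    (toE x) F, coeFn_toE x] with ω h1 h2
  rw [← h2]
  exact h1

theorem toE_le_toE : toE x ≤ toE y ↔ x ≤ y := by
  rw [← AEEqFun.coeFn_le, ← AEEqFun.coeFn_le]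
  refine eventually_congr ?_
  filter_upwards [coeFn_toE x, coeFn_toE y] with ω hx hy
  rw [hx, hy, EReal.coe_le_coe_iff]

theorem toE_congr_on (h : x =ᵐ[μ.restrict A] y) : toE x =ᵐ[μ.restrict A] toE y := by
  filter_upwards [h, (coeFn_toE x).restrict, (coeFn_toE y).restrict] with ω h hx hy
  rw [hx, hy, h]

theorem subE_le_subE_on (h : x =ᵐ[μ.restrict A] y) (hFG : F ≤ G) :
    subE y G ≤ᵐ[μ.restrict A] subE x F := by
  filter_upwards [h, ae_restrict_of_ae (AEEqFun.coeFn_le.2 hFG), (coeFn_subE x F).restrict,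
    (coeFn_subE y G).restrict] with ω h hFG hx hy
  rw [hx, hy, h]
  exact EReal.sub_le_sub le_rfl hFG

theorem subE_le_toE (h : toE (a - r) ≤ F) : subE a F ≤ toE r := by
  rw [← AEEqFun.coeFn_le] at h ⊢
  filter_upwards [h, coeFn_toE_sub a r, coeFn_subE a F, coeFn_toE r] with ω h h1 h2 h3
  rw [h1] at h
  rw [h2, h3]
  refine (EReal.sub_le_sub le_rfl h).trans ?_
  rw [← EReal.coe_sub, sub_sub_cancel]

theorem toE_le_subE_on (h : F ≤ᵐ[μ.restrict A] toE (a - r)) :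
    toE r ≤ᵐ[μ.restrict A] subE a F := by
  filter_upwards [h, ae_restrict_of_ae (coeFn_toE_sub a r), (coeFn_subE a F).restrict,
    (coeFn_toE r).restrict] with ω h h1 h2 h3
  rw [h1] at h
  rw [h2, h3]
  refine le_trans ?_ (EReal.sub_le_sub le_rfl h)
  rw [← EReal.coe_sub, sub_sub_cancel]

theorem toE_le_of_forall_sub_one_div_le
    (h : ∀ n : ℕ, ∀ᵐ ω ∂μ, ((a ω - 1 / (n + 1 : ℝ) : ℝ) : EReal) ≤ F ω) : toE a ≤ F := by
  rw [← AEEqFun.coeFn_le]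
  filter_upwards [ae_all_iff.2 h, coeFn_toE a] with ω h ha
  have hlim : Tendsto (fun n : ℕ => ((a ω - 1 / (n + 1 : ℝ) : ℝ) : EReal)) atTop
      (𝓝 ((a ω - 0 : ℝ) : EReal)) :=
    (continuous_coe_real_ereal.tendsto _).comp
      (tendsto_one_div_add_atTop_nhds_zero_nat.const_sub _)
  rw [ha, ← sub_zero (a ω)]
  exact le_of_tendsto' hlim h

theorem esssup_le_on [IsFiniteMeasure μ] {C : Set (Ω →ₘ[μ] EReal)} (hA : MeasurableSet A)
    (h : ∀ g ∈ C, g ≤ᵐ[μ.restrict A] F) : esssup C ≤ᵐ[μ.restrict A] F := by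
  classical
  have hf : Measurable (A.piecewise F fun _ => ⊤) := F.measurable.piecewise hA measurable_const
  have hcoe := AEEqFun.coeFn_mk (μ := μ) _ hf.aestronglyMeasurable
  have hle : esssup C ≤ AEEqFun.mk _ hf.aestronglyMeasurable := by
    refine (isLUB_esssup C).2 fun g hg => AEEqFun.coeFn_le.1 ?_
    filter_upwards [(ae_restrict_iff' hA).1 (h g hg), hcoe] with ω h1 h2
    rw [h2]
    by_cases hω : ω ∈ A
    · rw [piecewise_eq_of_mem _ _ _ hω]
      exact h1 hω
    · rw [piecewise_eq_of_notMem _ _ _ hω]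
      exact le_top
  filter_upwards [ae_restrict_of_ae (AEEqFun.coeFn_le.2 hle), hcoe.restrict, ae_restrict_mem hA]
    with ω h1 h2 hω
  rwa [h2, piecewise_eq_of_mem _ _ _ hω] at h1

end EssentialSupremum

section Conjugate

variable {Ω : Type*} {m0 : MeasurableSpace Ω} {μ : Measure[m0] Ω}

/-- The convex conjugate `f*(y) = esssup {E(xy) - f(x) ; x ∈ X}` for the pairing
`⟨x, y⟩ = E(xy)`. It is `fenchel` or `fenchelModule`, definitionally, when `E` is the conditional
expectation on `X = L^φ(𝓔)` or its extension on `X = L^φ_𝓕(𝓔)`. -/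
def conjugateOn (X : Set (Ω →ₘ[μ] ℝ)) (E f : (Ω →ₘ[μ] ℝ) → (Ω →ₘ[μ] ℝ)) (y : Ω →ₘ[μ] ℝ) :
    Ω →ₘ[μ] EReal :=
  esssup {g | ∃ x ∈ X, g = toE (E (x * y) - f x)}

/-- The family `{E(xy) - f*(y) ; y ∈ Y, E(y) = -1, y ≤ 0}` of lower bounds for `f(x)`. -/
def dualFamily (X Y : Set (Ω →ₘ[μ] ℝ)) (E f : (Ω →ₘ[μ] ℝ) → (Ω →ₘ[μ] ℝ)) (x : Ω →ₘ[μ] ℝ) :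
    Set (Ω →ₘ[μ] EReal) :=
  {g | ∃ y ∈ Y, E y = -1 ∧ y ≤ 0 ∧ g = subE (E (x * y)) (conjugateOn X E f y)}

/-- The dual representation `f(x) = esssup {E(xy) - f*(y) ; y ∈ Y, E(y) = -1, y ≤ 0}` on `X`. -/
def HasDualRepresentation (X Y : Set (Ω →ₘ[μ] ℝ)) (E f : (Ω →ₘ[μ] ℝ) → (Ω →ₘ[μ] ℝ)) : Prop :=
  ∀ x ∈ X, toE (f x) = esssup (dualFamily X Y E f x)

variable [IsFiniteMeasure μ] {X Y : Set (Ω →ₘ[μ] ℝ)} {E f : (Ω →ₘ[μ] ℝ) → (Ω →ₘ[μ] ℝ)}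
  {x : Ω →ₘ[μ] ℝ}

theorem toE_sub_le_conjugateOn (hx : x ∈ X) (y : Ω →ₘ[μ] ℝ) :
    toE (E (x * y) - f x) ≤ conjugateOn X E f y :=
  (isLUB_esssup _).1 ⟨x, hx, rfl⟩

theorem esssup_dualFamily_le (hx : x ∈ X) : esssup (dualFamily X Y E f x) ≤ toE (f x) := by
  refine (isLUB_esssup _).2 ?_
  rintro _ ⟨y, -, -, -, rfl⟩
  exact subE_le_toE (toE_sub_le_conjugateOn hx y)

end Conjugate

section Duality

variable {Ω : Type*} {m m0 : MeasurableSpace Ω} {μ : Measure[m0] Ω} {φ ψ : ℝ≥0 → ℝ≥0∞}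
  {ρ f : (Ω →ₘ[μ] ℝ) → (Ω →ₘ[μ] ℝ)} {c x y z : Ω →ₘ[μ] ℝ} {A B : Set Ω}

theorem exists_mem_L0pp_ae_eq_const {b : ℝ} (hb : 0 < b) : ∃ e ∈ L0pp m μ, ∀ᵐ ω ∂μ, e ω = b :=
  have h := AEEqFun.coeFn_const (μ := μ) Ω b
  ⟨AEEqFun.const Ω b, ⟨mem_L0_of_ae_eq (@stronglyMeasurable_const _ _ m _ b) h,
    h.mono fun _ h => h ▸ hb⟩, h⟩

theorem condEExt_mul_eq_on (hm : m ≤ m0) (hφ : Monotone φ) (hx : x ∈ hull m (orlicz m0 μ φ))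
    (hz : z ∈ orlicz m0 μ φ) (hy : y ∈ orlicz m0 μ (conj φ)) (hA : MeasurableSet[m] A)
    (h : x =ᵐ[μ.restrict A] z) :
    condEExt m μ (x * y) =ᵐ[μ.restrict A] condE m μ (z * y) :=
  condEExt_eq_on hm
    (mul_mem_hull (fun _ hx _ hy => integrable_mul_of_mem_orlicz hφ hx hy) hx (subset_hull _ hy))
    (integrable_mul_of_mem_orlicz hφ hz hy) hA (mul_congr_on h (ae_eq_refl ⇑y))

variable [IsFiniteMeasure μ]

theorem exists_feasible_dual (hm : m ≤ m0) (hφ : IsYoung φ)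
    (hρ : IsCondConvexRiskMeasure m μ φ ψ ρ)
    (hlsc : WeakLSC m μ (hull m (orlicz m0 μ φ)) (hull m (orlicz m0 μ (conj φ)))
      (extension m φ ρ))
    (hx : x ∈ orlicz m0 μ φ) (hc : c ∈ L0 m μ) (hcρ : ∀ᵐ ω ∂μ, c ω < ρ x ω)
    (hBm : MeasurableSet[m] B) (hB : μ B ≠ 0) :
    ∃ A ⊆ B, MeasurableSet[m] A ∧ μ A ≠ 0 ∧ ∃ y ∈ orlicz m0 μ (conj φ), condE m μ y = -1 ∧ y ≤ 0 ∧
      ∀ u ∈ orlicz m0 μ φ, ∀ᵐ ω ∂μ.restrict A,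
        condE m μ (u * y) ω - ρ u ω ≤ condE m μ (x * y) ω - c ω := by
  obtain ⟨D', hD'B, hD'm, hD', l, -, -, -, hxl, -, hρl⟩ :=
    hρ.exists_cash_shift hm hφ.mono hφ.exists_pos_lt_top hx hc hBm hB
  obtain ⟨D, hDD', hDm, hD, R, hR, e, he, havoid⟩ :=
    exists_finset_avoiding_sublevel hm hφ.mono hρ hlsc hx hc hcρ hD'm hD'
  have hz₀ : x + l ∈ sublevelOn μ φ ρ c D := ⟨hxl, (eq_on_mono hDD' hρl).le⟩
  obtain ⟨A', hA'D, hA'm, hA', y, hy, hsep⟩ :=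
    exists_separatesOn hm hφ.mono hρ hDm hD hR hx ⟨_, hz₀⟩ he havoid
  obtain ⟨A, hAA', hA⟩ :=
    exists_feasible_dual_of_separatesOn hm hφ hρ hA'm hA' hx hc hy hz₀ hsep
  exact ⟨A, hAA'.trans (hA'D.trans (hDD'.trans hD'B)), hA⟩

theorem toE_le_esssup_dualFamily (hm : m ≤ m0) (hφ : IsYoung φ)
    (hρ : IsCondConvexRiskMeasure m μ φ ψ ρ)
    (hlsc : WeakLSC m μ (hull m (orlicz m0 μ φ)) (hull m (orlicz m0 μ (conj φ)))
      (extension m φ ρ))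
    (hx : x ∈ orlicz m0 μ φ) (hc : c ∈ L0 m μ) (hcρ : ∀ᵐ ω ∂μ, c ω < ρ x ω) :
    toE c ≤ esssup (dualFamily (orlicz m0 μ φ) (orlicz m0 μ (conj φ)) (condE m μ) ρ x) := by
  refine AEEqFun.coeFn_le.1 (ae_of_forall_exists_subset hm fun B hBm hB => ?_)
  obtain ⟨A, hAB, hAm, hA, y, hy, hy1, hy0, hyA⟩ :=
    exists_feasible_dual hm hφ hρ hlsc hx hc hcρ hBm hB
  have hconj : conjugateOn (orlicz m0 μ φ) (condE m μ) ρ y ≤ᵐ[μ.restrict A]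
      toE (condE m μ (x * y) - c) := by
    refine esssup_le_on (hm _ hAm) ?_
    rintro _ ⟨u, hu, rfl⟩
    filter_upwards [hyA u hu, ae_restrict_of_ae (coeFn_toE_sub (condE m μ (u * y)) (ρ u)),
      ae_restrict_of_ae (coeFn_toE_sub (condE m μ (x * y)) c)] with ω h h1 h2
    rwa [h1, h2, EReal.coe_le_coe_iff]
  exact ⟨A, hAB, hAm, hA, (toE_le_subE_on hconj).trans
    (ae_restrict_of_ae (AEEqFun.coeFn_le.2 ((isLUB_esssup _).1 ⟨y, hy, hy1, hy0, rfl⟩)))⟩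

theorem hasDualRepresentation_of_weakLSC (hm : m ≤ m0) (hφ : IsYoung φ)
    (hρ : IsCondConvexRiskMeasure m μ φ ψ ρ)
    (hlsc : WeakLSC m μ (hull m (orlicz m0 μ φ)) (hull m (orlicz m0 μ (conj φ)))
      (extension m φ ρ)) :
    HasDualRepresentation (orlicz m0 μ φ) (orlicz m0 μ (conj φ)) (condE m μ) ρ := by
  intro x hx
  refine le_antisymm (toE_le_of_forall_sub_one_div_le fun n => ?_) (esssup_dualFamily_le hx)
  obtain ⟨f, hf, hρf⟩ := hρ.mem_L0 hx
  obtain ⟨c, hc, hcf⟩ := exists_mem_L0_ae_eq (μ := μ) hm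
    (hf.sub (@stronglyMeasurable_const _ _ m _ (1 / (n + 1 : ℝ))))
  have hcρ : ∀ᵐ ω ∂μ, c ω = ρ x ω - 1 / (n + 1 : ℝ) := by
    filter_upwards [hcf, hρf] with ω h1 h2
    rw [h1, h2, Pi.sub_apply]
  have hlt : ∀ᵐ ω ∂μ, c ω < ρ x ω :=
    hcρ.mono fun ω h => h ▸ sub_lt_self _ Nat.one_div_pos_of_nat
  filter_upwards [AEEqFun.coeFn_le.2 (toE_le_esssup_dualFamily hm hφ hρ hlsc hx hc hlt),
    coeFn_toE c, hcρ] with ω h h1 h2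
  rwa [h1, h2] at h

theorem conjugateOn_hull_le (hm : m ≤ m0) (hφ : Monotone φ) (hy : y ∈ orlicz m0 μ (conj φ)) :
    conjugateOn (hull m (orlicz m0 μ φ)) (condEExt m μ) (extension m φ ρ) y ≤
      conjugateOn (orlicz m0 μ φ) (condE m μ) ρ y := by
  refine (isLUB_esssup _).2 ?_
  rintro _ ⟨x, hx, rfl⟩
  obtain ⟨A, xs, hA, hxs, hxA, hρA⟩ := stableExt_spec (f := ρ) hm hx
  refine AEEqFun.coeFn_le.1 (hA.ae_of_forall fun k => ?_)
  have hE := condEExt_mul_eq_on hm hφ hx (hxs k) hy (hA.1 k) (hxA k)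
  exact (toE_congr_on (sub_congr_on hE (hρA k))).trans_le
    (ae_restrict_of_ae (AEEqFun.coeFn_le.2 (toE_sub_le_conjugateOn (hxs k) y)))

theorem HasDualRepresentation.extension (hm : m ≤ m0) (hφ : IsYoung φ)
    (hrep : HasDualRepresentation (orlicz m0 μ φ) (orlicz m0 μ (conj φ)) (condE m μ) ρ) :
    HasDualRepresentation (hull m (orlicz m0 μ φ)) (hull m (orlicz m0 μ (conj φ)))
      (condEExt m μ) (extension m φ ρ) := by
  intro x hx
  refine le_antisymm ?_ (esssup_dualFamily_le hx)
  obtain ⟨A, xs, hA, hxs, hxA, hρA⟩ := stableExt_spec (f := ρ) hm hx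
  refine AEEqFun.coeFn_le.1 (hA.ae_of_forall fun k => (toE_congr_on (hρA k)).trans_le ?_)
  rw [hrep (xs k) (hxs k)]
  refine esssup_le_on (hm _ (hA.1 k)) ?_
  rintro _ ⟨y, hy, hy1, hy0, rfl⟩
  have hE := condEExt_mul_eq_on hm hφ.mono hx (hxs k) hy (hA.1 k) (hxA k)
  have hy1' : condEExt m μ y = -1 := by
    rw [condEExt_eq hm (integrable_of_mem_orlicz_conj hφ.mono hφ.exists_pos_lt_top hy), hy1]
  exact (subE_le_subE_on hE (conjugateOn_hull_le hm hφ.mono hy)).trans (ae_restrict_of_ae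
    (AEEqFun.coeFn_le.2 ((isLUB_esssup _).1 ⟨y, subset_hull _ hy, hy1', hy0, rfl⟩)))

theorem HasDualRepresentation.weakLSC (hm : m ≤ m0) (hφ : Monotone φ)
    (hrep : HasDualRepresentation (hull m (orlicz m0 μ φ)) (hull m (orlicz m0 μ (conj φ)))
      (condEExt m μ) f) :
    WeakLSC m μ (hull m (orlicz m0 μ φ)) (hull m (orlicz m0 μ (conj φ))) f := by
  refine weakLSC_iff.2 fun c _ x hx => ?_
  contrapose!
  intro hclosure
  rw [← toE_le_toE, hrep x hx]
  refine (isLUB_esssup _).2 ?_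
  rintro _ ⟨y, hy, -, -, rfl⟩
  refine subE_le_toE (toE_le_of_forall_sub_one_div_le fun n => ?_)
  obtain ⟨e, he, hen⟩ :=
    exists_mem_L0pp_ae_eq_const (m := m) (μ := μ) (Nat.one_div_pos_of_nat (α := ℝ) (n := n))
  obtain ⟨z, hz, hnear, hzc⟩ := hclosure {y} (by simpa only [Finset.coe_singleton,
    singleton_subset_iff] using hy) e he
  have hint {u : Ω →ₘ[μ] ℝ} (hu : u ∈ hull m (orlicz m0 μ φ)) :
      u * y ∈ hull m {u : Ω →ₘ[μ] ℝ | Integrable u μ} :=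
    mul_mem_hull (fun _ hx _ hy => integrable_mul_of_mem_orlicz hφ hx hy) hu hy
  have hpair : condEExt m μ ((z - x) * y) = condEExt m μ (z * y) - condEExt m μ (x * y) := by
    rw [sub_mul, condEExt_sub hm (hint hz) (hint hx)]
  filter_upwards [hnear y (Finset.mem_singleton_self y), hen, AEEqFun.coeFn_le.2 hzc,
    AEEqFun.coeFn_le.2 (toE_sub_le_conjugateOn (E := condEExt m μ) (f := f) hz y),
    coeFn_toE_sub (condEExt m μ (z * y)) (f z), AEEqFun.coeFn_sub (condEExt m μ (x * y)) c,
    AEEqFun.coeFn_sub (condEExt m μ (z * y)) (condEExt m μ (x * y))]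
    with ω hnear hen hzc hz h1 h2 h3
  rw [hpair, h3, hen, Pi.sub_apply] at hnear
  rw [h1] at hz
  refine le_trans (EReal.coe_le_coe_iff.2 ?_) hz
  rw [h2, Pi.sub_apply]
  linarith [(abs_le.1 hnear).1]

end Duality

end CondRisk

end

open CondRisk in
theorem theorem5p7_general {Ω : Type*} {m m0 : MeasurableSpace Ω} (hm : m ≤ m0)
    {μ : Measure[m0] Ω} [IsFiniteMeasure μ] {φ ψ : ℝ≥0 → ℝ≥0∞} (hφ : IsYoung φ)
    {ρ : (Ω →ₘ[μ] ℝ) → (Ω →ₘ[μ] ℝ)} (hρ : IsCondConvexRiskMeasure m μ φ ψ ρ) :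
    List.TFAE [
      WeakLSC m μ (orliczModule m μ φ) (orliczModule m μ (conj φ)) (extension m φ ρ),
      HasDualRepresentation (orliczModule m μ φ) (orliczModule m μ (conj φ)) (condEExt m μ)
        (extension m φ ρ),
      HasDualRepresentation (orlicz m0 μ φ) (orlicz m0 μ (conj φ)) (condE m μ) ρ] := by
  rw [orliczModule_eq_hull hm hφ.mono hφ.map_zero,
    orliczModule_eq_hull hm (conj_mono φ) (conj_zero φ)]
  tfae_have 1 → 3 := hasDualRepresentation_of_weakLSC hm hφ hρ
  tfae_have 3 → 2 := HasDualRepresentation.extension hm hφ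
  tfae_have 2 → 1 := HasDualRepresentation.weakLSC hm hφ.mono
  tfae_finish

theorem theorem5p7 {Ω : Type*} {m m0 : MeasurableSpace Ω} (hm : m ≤ m0) (μ : Measure[m0] Ω)
    [IsProbabilityMeasure μ] (φ ψ : ℝ≥0 → ℝ≥0∞) (hφ : CondRisk.IsYoung φ)
    (hψ : CondRisk.IsYoung ψ) (hψφ : ∀ t, ψ t ≤ φ t) (ρ : (Ω →ₘ[μ] ℝ) → (Ω →ₘ[μ] ℝ))
    (hρ : CondRisk.IsCondConvexRiskMeasure m μ φ ψ ρ) :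
    List.TFAE [
      CondRisk.WeakLSC m μ (CondRisk.orliczModule m μ φ)
        (CondRisk.orliczModule m μ (CondRisk.conj φ)) (CondRisk.extension m φ ρ),
      ∀ x ∈ CondRisk.orliczModule m μ φ,
        CondRisk.toE (CondRisk.extension m φ ρ x) =
          CondRisk.esssup {g | ∃ y ∈ CondRisk.orliczModule m μ (CondRisk.conj φ),
            CondRisk.condEExt m μ y = -1 ∧ y ≤ 0 ∧
            g = CondRisk.subE (CondRisk.condEExt m μ (x * y))
              (CondRisk.fenchelModule m φ (CondRisk.extension m φ ρ) y)},
      ∀ x ∈ CondRisk.orlicz m0 μ φ,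
        CondRisk.toE (ρ x) =
          CondRisk.esssup {g | ∃ y ∈ CondRisk.orlicz m0 μ (CondRisk.conj φ),
            CondRisk.condE m μ y = -1 ∧ y ≤ 0 ∧
            g = CondRisk.subE (CondRisk.condE m μ (x * y)) (CondRisk.fenchel m φ ρ y)}] :=
  theorem5p7_general hm hφ hρ
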